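/- Let $n\ge 1$. Let $G$ be a connected bipartite graph embedded in the oriented plane, with black vertices $b_1,\dots,b_N$, white vertices $w_1,\dots,w_N$ and finite edge set $E$ (multiple edges allowed). Let $G$ be ciliated: at every vertex a cilium is placed in one of the corners, so that the incident half-edges are linearly ordered, starting at the cilium, counterclockwise at black vertices and clockwise at white vertices. Let $\epsilon:E\to\{\pm1\}$ be Kasteleyn signs with respect to the ciliation: for every internal face with $l$ sides and $k$ inward-pointing cilia, the product of the signs of its sides is $(-1)^{l/2-1}$ if $n$ is odd and $(-1)^{l/2-1-k}$ if $n$ is even (an edge with the same face on both sides counts as two sides). Let $q\in\mathbb C\setminus\{0\}$ be such that $q=\pm1$ or $q^{2m}\ne1$ for $m=2,\dots,n$. Put $[k]=\sum_{i=1}^{k}q^{-k-1+2i}$ and $[k]!=[1][2]\cdots[k]$; let $\ell(\sigma)$ be the number of inversions of a permutation $\sigma$. Let $\mathbb A$ be a complex algebra and $\Phi_q$ an edge-commuting $n\times n$ quantum connection on $G$ with entries in $\mathbb A$: a matrix $\Phi_q(e)=(\Phi_q(e)_{ij})$ over $\mathbb A$ for every $e\in E$, such that entries on different edges commute and every $2\times2$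 submatrix $\begin{pmatrix}a&b\\c&d\end{pmatrix}$ of each $\Phi_q(e)$ satisfies $ab=q\,ba$, $cd=q\,dc$, $ac=q\,ca$, $bd=q\,db$, $bc=cb$, $ad-da=(q-q^{-1})bc$. An $n$-multiweb is a function $m:E\to\{0,\dots,n\}$, $e\mapsto m_e$, whose sum over the edges at each vertex is $n$; $\Omega_n$ is the set of these. For $m\in\Omega_n$ let $G_m$ be the ciliated plane graph obtained by splitting each edge $e$ into $m_e$ parallel copies (no cilium between copies), each copy carrying $\Phi_q(e)$. The quantum trace $\mathrm{tr}_q(\Phi_q,m)\in\mathbb A$ is $\prod_e([m_e]!)^{-1}$ times the contraction of the codeterminants $\sum_{\sigma\in\mathfrak S_n}(-q)^{\ell(\sigma)}x_{\sigma(1)}\otimes\dots\otimes x_{\sigma(n)}$ at the black vertices of $G_m$ (the $i$-th factor belonging to the $i$-th half-edge), the matrices on the edges of $G_m$, and the dual codeterminants $\sum_{\sigma}(-q)^{\ell(\sigma)}x^*_{\sigma(1)}\otimes\dots\otimes x^*_{\sigma(n)}$ at the white vertices, where an edge with index $j$ at its black end and index $i$ at its white end contributes $\Phi_q(e)_{ij}$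 and these entries are multiplied in the order of the half-edges at each white vertex. Put $$Z_q(\Phi_q)=q^{-N\binom n2}\sum_{m\in\Omega_n}\mathrm{tr}_q(\Phi_q,m).$$ The blow-up graph $\tilde G$ has $n$ copies of every vertex of $G$ and, over every edge $e$ of $G$, one edge from each copy of the black end of $e$ to each copy of its white end; the copies of the black vertices, and those of the white vertices, are ordered lexicographically, hence labelled by $1,\dots,Nn$. A dimer cover $\tilde m$ of $\tilde G$ determines: the permutation $\tilde\sigma\in\mathfrak S_{Nn}$ that sends the label of a white vertex to the label of the black vertex matched to it; for each $e\in E$, the number $m_e$ of edges of $\tilde m$ over $e$, and the sets $S_e,T_e\subset\{1,\dots,n\}$ of indices of the copies of the white and of the black end of $e$ that are matched over $e$; for each vertex $v$ of $G$, the permutation $\sigma_v\in\mathfrak S_n$ whose one-line notation lists the sets $S_e$ ($v$ white) or $T_e$ ($v$ black) of the half-edges at $v$, in their linear order, each set in increasing order; and, for each $e$, the permutation $\sigma_e\in\mathfrak S_{m_e}$ given by the matching $S_e\to T_e$ after the increasing identifications of $S_e$ and $T_e$ with $\{1,\dots,m_e\}$. Let $e_{\tilde\imath}$ be the edge of $G$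 under the dimer at the $\tilde\imath$-th white vertex of $\tilde G$, and let $\tilde\Phi_{\tilde\imath}=\Phi_q(e_{\tilde\imath})_{ij}$, where this dimer joins the $i$-th copy of the white end of $e_{\tilde\imath}$ to the $j$-th copy of its black end. Put $$\mathrm{Kdet}_q(\Phi_q)=q^{-N\binom n2}\sum_{\tilde m}(-1)^{\tilde\sigma}\Big(\prod_v q^{\ell(\sigma_v)}\Big)\Big(\prod_{e\in E}q^{\binom{m_e}2}q^{\ell(\sigma_e)}\Big)\Big(\prod_{\tilde\imath=1}^{Nn}\epsilon(e_{\tilde\imath})\Big)\,\tilde\Phi_{1}\tilde\Phi_{2}\cdots\tilde\Phi_{Nn},$$ the sum running over all dimer covers $\tilde m$ of $\tilde G$. Then $Z_q(\Phi_q)=\pm\,\mathrm{Kdet}_q(\Phi_q)$, with a global sign that depends only on $n$, the ciliated plane graph $G$ with its vertex labelling, and $\epsilon$ (not on $q$, $\mathbb A$ or $\Phi_q$). -/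

import Mathlib

open scoped BigOperators

universe u v

/-! ### Ciliated bipartite graphs and their planarity -/

/-- A bipartite multigraph with black vertices `b_1, …, b_N`, white vertices `w_1, …, w_N` and edge
set `E` (parallel edges allowed, every edge oriented from its black to its white end), together
with a ciliation: at each vertex the incident half-edges are listed in a linear order.

For a graph embedded in the oriented plane, the list at a black vertex reads the half-edges
counterclockwise, and the list at a white vertex reads them clockwise, in both cases starting at
the cilium of the vertex. Hence the lists record the cyclic orders around the vertices, that is,
the embedding as a combinatorial map, as well as the positions of the cilia: the cilium of a vertex
lies in the corner between the last and the first half-edge of its list. -/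
structure CiliatedGraph (N : ℕ) (E : Type u) where
  black : E → Fin N
  white : E → Fin N
  blackOrder : Fin N → List E
  whiteOrder : Fin N → List E
  nodup_blackOrder : ∀ b, (blackOrder b).Nodup
  nodup_whiteOrder : ∀ w, (whiteOrder w).Nodup
  mem_blackOrder : ∀ b e, e ∈ blackOrder b ↔ black e = b
  mem_whiteOrder : ∀ w e, e ∈ whiteOrder w ↔ white e = w

namespace CiliatedGraph

variable {N : ℕ} {E : Type u}

/-- The simple graph on the `2N` vertices (`Sum.inl` black, `Sum.inr` white) in which two vertices
are adjacent when some edge joins them. -/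
def toSimpleGraph (G : CiliatedGraph N E) : SimpleGraph (Fin N ⊕ Fin N) :=
  SimpleGraph.fromRel fun x y => ∃ e, x = Sum.inl (G.black e) ∧ y = Sum.inr (G.white e)

/-- The edge that follows `e` in the counterclockwise cyclic order at the black end of `e`. -/
def nextBlack [DecidableEq E] (G : CiliatedGraph N E) : Equiv.Perm E where
  toFun e := (G.blackOrder (G.black e)).formPerm e
  invFun e := (G.blackOrder (G.black e)).formPerm.symm e
  left_inv e := by
    have h : G.black ((G.blackOrder (G.black e)).formPerm e) = G.black e := by
      rw [← G.mem_blackOrder, List.formPerm_mem_iff_mem, G.mem_blackOrder]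
    simp [h]
  right_inv e := by
    have h : G.black ((G.blackOrder (G.black e)).formPerm.symm e) = G.black e := by
      rw [← G.mem_blackOrder, ← List.formPerm_mem_iff_mem, Equiv.apply_symm_apply,
        G.mem_blackOrder]
    simp [h]

/-- The edge that follows `e` in the clockwise cyclic order at the white end of `e`. -/
def nextWhite [DecidableEq E] (G : CiliatedGraph N E) : Equiv.Perm E where
  toFun e := (G.whiteOrder (G.white e)).formPerm e
  invFun e := (G.whiteOrder (G.white e)).formPerm.symm e
  left_inv e := by
    have h : G.white ((G.whiteOrder (G.white e)).formPerm e) = G.white e := by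
      rw [← G.mem_whiteOrder, List.formPerm_mem_iff_mem, G.mem_whiteOrder]
    simp [h]
  right_inv e := by
    have h : G.white ((G.whiteOrder (G.white e)).formPerm.symm e) = G.white e := by
      rw [← G.mem_whiteOrder, ← List.formPerm_mem_iff_mem, Equiv.apply_symm_apply,
        G.mem_whiteOrder]
    simp [h]

/-- Two steps along the boundary of a face that is kept on the left: go along `e` from black to
white, leave the white vertex along the next edge clockwise, `e' = nextWhite e`, and leave the black
end of `e'` along the next edge clockwise, which is `nextBlack⁻¹ e'`. -/
def faceStep [DecidableEq E] (G : CiliatedGraph N E) : Equiv.Perm E :=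
  G.nextBlack⁻¹ * G.nextWhite

/-- The faces of the embedded graph, the outer one included: the cycles of `faceStep`. -/
def Face [DecidableEq E] (G : CiliatedGraph N E) : Type u :=
  Quotient (Equiv.Perm.SameCycle.setoid G.faceStep)

/-- The face on the left of `e`, for `e` oriented from black to white. -/
def leftFace [DecidableEq E] (G : CiliatedGraph N E) (e : E) : G.Face :=
  Quotient.mk (Equiv.Perm.SameCycle.setoid G.faceStep) e

/-- The cyclic orders of `G` are those of a connected graph embedded in the sphere (equivalently, in
the plane): `G` is connected, and Euler's formula `|V| - |E| + |F| = 2` holds. -/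
structure IsPlane [Fintype E] [DecidableEq E] (G : CiliatedGraph N E) : Prop where
  connected : G.toSimpleGraph.Connected
  euler : 2 * N + Nat.card G.Face = Fintype.card E + 2

open Classical in
/-- The edges that the boundary walk of the face `f` (with `f` on the left) traverses from black to
white. The edges which it traverses from white to black are the `nextWhite e` for these `e`. In
particular `f` has `2 * #(faceEdges f)` sides. -/
noncomputable def faceEdges [Fintype E] [DecidableEq E] (G : CiliatedGraph N E) (f : G.Face) :
    Finset E :=
  Finset.univ.filter fun e => G.leftFace e = f

open Classical in
/-- The number of cilia pointing into the face `f`. The corners of `f` are, for `e ∈ faceEdges f`,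
the corner at a white vertex from `e` to `nextWhite e` and the one at a black vertex from `e` to
`nextBlack e`; such a corner holds a cilium when `e` is the last edge in the list of the vertex. -/
noncomputable def ciliaCount [Fintype E] [DecidableEq E] (G : CiliatedGraph N E) (f : G.Face) : ℕ :=
  ((G.faceEdges f).filter fun e => (G.whiteOrder (G.white e)).getLast? = some e).card +
    ((G.faceEdges f).filter fun e => (G.blackOrder (G.black e)).getLast? = some e).card

/-- `ε` is a choice of Kasteleyn signs for the ciliated plane graph `G` with outer face `outer`: for
every internal face with `l` sides and `k` inward-pointing cilia the product of the signs of its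
sides is `(-1)^(l/2 - 1)` if `n` is odd and `(-1)^(l/2 - 1 - k)` if `n` is even. -/
def IsKasteleyn [Fintype E] [DecidableEq E] (G : CiliatedGraph N E) (n : ℕ) (outer : G.Face)
    (ε : E → ℤˣ) : Prop :=
  ∀ f : G.Face, f ≠ outer →
    ∏ e ∈ G.faceEdges f, ε e * ε (G.nextWhite e) =
      if Odd n then (-1 : ℤˣ) ^ (((G.faceEdges f).card : ℤ) - 1)
      else (-1 : ℤˣ) ^ (((G.faceEdges f).card : ℤ) - 1 - (G.ciliaCount f : ℤ))

/-! ### Multiwebs -/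

/-- The set `Ω_n` of `n`-multiwebs: edge multiplicities in `{0, …, n}` with sum `n` at each
vertex. -/
def multiwebs [Fintype E] [DecidableEq E] (G : CiliatedGraph N E) (n : ℕ) :
    Finset (E → Fin (n + 1)) :=
  Finset.univ.filter fun m =>
    (∀ b, ∑ e ∈ Finset.univ.filter (fun e => G.black e = b), (m e : ℕ) = n) ∧
      (∀ w, ∑ e ∈ Finset.univ.filter (fun e => G.white e = w), (m e : ℕ) = n)

/-- Replace every edge in a list by its `m e` parallel copies, put in its place. -/
def splitList (m : E → ℕ) (l : List E) : List (Σ e, Fin (m e)) :=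
  l.flatMap fun e => (List.finRange (m e)).map fun k => ⟨e, k⟩

theorem mem_splitList (m : E → ℕ) (l : List E) (x : Σ e, Fin (m e)) :
    x ∈ splitList m l ↔ x.1 ∈ l := by
  obtain ⟨e, k⟩ := x
  simp only [splitList, List.mem_flatMap, List.mem_map, List.mem_finRange, true_and]
  constructor
  · rintro ⟨e', he', k', h⟩
    cases h
    exact he'
  · intro h
    exact ⟨e, h, k, rfl⟩

theorem nodup_splitList (m : E → ℕ) (l : List E) (hl : l.Nodup) : (splitList m l).Nodup := by
  rw [splitList, List.nodup_flatMap]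
  refine ⟨fun e _ => (List.nodup_finRange _).map (fun a b h => by simpa using h), ?_⟩
  refine hl.imp fun {a b} hab x hx hy => ?_
  simp only [List.mem_map] at hx hy
  obtain ⟨i, _, rfl⟩ := hx
  obtain ⟨j, _, h⟩ := hy
  exact hab (congrArg Sigma.fst h).symm

/-- The split graph `G_m`: every edge `e` is replaced by `m e` parallel copies, with the induced
embedding and ciliation (no cilium between copies of one edge). Parallel copies that are met in
counterclockwise order around the black end are met in clockwise order around the white end, so they
appear in the same order in both lists. -/
def split (G : CiliatedGraph N E) (m : E → ℕ) : CiliatedGraph N (Σ e, Fin (m e)) where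
  black x := G.black x.1
  white x := G.white x.1
  blackOrder b := splitList m (G.blackOrder b)
  whiteOrder w := splitList m (G.whiteOrder w)
  nodup_blackOrder b := nodup_splitList m _ (G.nodup_blackOrder b)
  nodup_whiteOrder w := nodup_splitList m _ (G.nodup_whiteOrder w)
  mem_blackOrder b x := by rw [mem_splitList, G.mem_blackOrder]
  mem_whiteOrder w x := by rw [mem_splitList, G.mem_whiteOrder]

end CiliatedGraph

/-! ### Quantum integers, quantum matrices, quantum connections -/

/-- The standing assumption on `q`: it is nonzero, and it is not a `2m`-th root of unity for
`2 ≤ m ≤ n`, except that `q = 1` and `q = -1` are allowed. -/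
def QAdmissible (n : ℕ) (q : ℂ) : Prop :=
  q ≠ 0 ∧ ∀ m : ℕ, 2 ≤ m → m ≤ n → q ^ (2 * m) = 1 → q = 1 ∨ q = -1

/-- The quantum integer `[k] = q^(k-1) + q^(k-3) + ⋯ + q^(1-k)`. -/
noncomputable def qInt (q : ℂ) (k : ℕ) : ℂ :=
  ∑ i ∈ Finset.range k, q ^ ((k : ℤ) - 1 - 2 * (i : ℤ))

/-- The quantum factorial `[k]! = [k] ⋯ [2] [1]`. -/
noncomputable def qFactorial (q : ℂ) (k : ℕ) : ℂ :=
  ∏ i ∈ Finset.range k, qInt q (i + 1)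

/-- `M` is an `n × n` quantum matrix with entries in the complex algebra `A`: every `2 × 2`
submatrix `(a b; c d)` satisfies `ab = q ba`, `cd = q dc`, `ac = q ca`, `bd = q db`, `bc = cb` and
`ad - da = (q - q⁻¹) bc`. -/
def IsQuantumMatrix {n : ℕ} {A : Type v} [Ring A] [Algebra ℂ A] (q : ℂ)
    (M : Matrix (Fin n) (Fin n) A) : Prop :=
  ∀ i k j l : Fin n, i < k → j < l →
    M i j * M i l = q • (M i l * M i j) ∧
    M k j * M k l = q • (M k l * M k j) ∧
    M i j * M k j = q • (M k j * M i j) ∧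
    M i l * M k l = q • (M k l * M i l) ∧
    M i l * M k j = M k j * M i l ∧
    M i j * M k l - M k l * M i j = (q - q⁻¹) • (M i l * M k j)

/-- An edge-commuting `n × n` quantum connection with entries in `A`: a quantum matrix on each edge,
such that entries on different edges commute. -/
structure IsQuantumConnection {n : ℕ} {E : Type u} {A : Type v} [Ring A] [Algebra ℂ A] (q : ℂ)
    (Φ : E → Matrix (Fin n) (Fin n) A) : Prop where
  quantum : ∀ e, IsQuantumMatrix q (Φ e)
  commute : ∀ e e', e ≠ e' → ∀ i j i' j', Commute (Φ e i j) (Φ e' i' j')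

/-- The number of inversions of a word; for the one-line notation of a permutation `σ` this is the
length `ℓ(σ)`. -/
def inversionCount {n : ℕ} : List (Fin n) → ℕ
  | [] => 0
  | a :: l => l.countP (fun b => decide (b < a)) + inversionCount l

/-- The coordinates in the standard basis of the quantum codeterminant
`∑_σ (-q)^ℓ(σ) x_σ(1) ⊗ ⋯ ⊗ x_σ(n)`, and of the quantum dual codeterminant in the dual basis: the
coefficient of `x_{c 1} ⊗ ⋯ ⊗ x_{c n}`, for a word `c` in the colors. -/
noncomputable def codet {n : ℕ} (q : ℂ) (c : List (Fin n)) : ℂ :=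
  if c.Nodup ∧ c.length = n then (-q) ^ inversionCount c else 0

namespace CiliatedGraph

variable {N : ℕ} {E : Type u}

/-- The quantum trace of an `n`-valent graph `H` (a proper multiweb) with a matrix `Φ e` on each
edge: the contraction of the codeterminants at the black vertices, the matrices on the edges and the
dual codeterminants at the white vertices, written in coordinates. The sum is over all indices
`β e` at the black half-edges and `ω e` at the white half-edges; the entries `(Φ e)_{ω e, β e}` are
multiplied at each white vertex in the order of the half-edges there. -/
noncomputable def properTrace [Fintype E] [DecidableEq E] {n : ℕ} {A : Type v} [Ring A] [Algebra ℂ A]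
    (H : CiliatedGraph N E) (q : ℂ) (Φ : E → Matrix (Fin n) (Fin n) A) : A :=
  ∑ β : E → Fin n, ∑ ω : E → Fin n,
    ((∏ b, codet q ((H.blackOrder b).map β)) * (∏ w, codet q ((H.whiteOrder w).map ω))) •
      (List.ofFn fun w : Fin N => ((H.whiteOrder w).map fun e => Φ e (ω e) (β e)).prod).prod

/-- The quantum trace `tr_q(Φ, m)` of a multiweb `m`: the quantum trace of the split graph `G_m`,
where each copy of `e` carries the matrix `Φ e`, divided by the product of the `[m_e]!`. -/
noncomputable def quantumTrace [Fintype E] [DecidableEq E] {n : ℕ} {A : Type v} [Ring A]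
    [Algebra ℂ A] (G : CiliatedGraph N E) (q : ℂ) (Φ : E → Matrix (Fin n) (Fin n) A)
    (m : E → ℕ) : A :=
  (∏ e, qFactorial q (m e))⁻¹ • (G.split m).properTrace q fun x => Φ x.1

/-- The quantum partition function `Z_q(Φ) = q^(-N (n choose 2)) ∑_{m ∈ Ω_n} tr_q(Φ, m)`. -/
noncomputable def partitionFunction [Fintype E] [DecidableEq E] {n : ℕ} {A : Type v} [Ring A]
    [Algebra ℂ A] (G : CiliatedGraph N E) (q : ℂ) (Φ : E → Matrix (Fin n) (Fin n) A) : A :=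
  q ^ (-((N * n.choose 2 : ℕ) : ℤ)) •
    ∑ m ∈ G.multiwebs n, G.quantumTrace q Φ fun e => (m e : ℕ)

/-! ### Dimer covers of the blow-up graph and the Kasteleyn determinant -/

/-- A dimer cover of the blow-up graph. The blow-up graph has `n` copies `(v, i)` of each vertex `v`
of `G`, and its edge `(e, i, j)` lies over `e` and joins the copy `i` of the white end of `e` to the
copy `j` of the black end. A dimer cover is a set of edges that covers each vertex exactly once. -/
def DimerCover (G : CiliatedGraph N E) (n : ℕ) : Type u :=
  {D : Finset (E × Fin n × Fin n) //
    (∀ w i, ∃! x, x ∈ D ∧ G.white x.1 = w ∧ x.2.1 = i) ∧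
    (∀ b j, ∃! x, x ∈ D ∧ G.black x.1 = b ∧ x.2.2 = j)}

open Classical in
noncomputable instance [Fintype E] (G : CiliatedGraph N E) (n : ℕ) : Fintype (G.DimerCover n) :=
  inferInstanceAs (Fintype {D : Finset (E × Fin n × Fin n) //
    (∀ w i, ∃! x, x ∈ D ∧ G.white x.1 = w ∧ x.2.1 = i) ∧
    (∀ b j, ∃! x, x ∈ D ∧ G.black x.1 = b ∧ x.2.2 = j)})

namespace DimerCover

variable {G : CiliatedGraph N E} {n : ℕ}

/-- The edge of the dimer cover at a white vertex of the blow-up graph. -/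
noncomputable def whiteEdge (D : G.DimerCover n) (p : Fin N × Fin n) : E × Fin n × Fin n :=
  (D.2.1 p.1 p.2).choose

/-- The edge of the dimer cover at a black vertex of the blow-up graph. -/
noncomputable def blackEdge (D : G.DimerCover n) (p : Fin N × Fin n) : E × Fin n × Fin n :=
  (D.2.2 p.1 p.2).choose

theorem whiteEdge_spec (D : G.DimerCover n) (p : Fin N × Fin n) :
    D.whiteEdge p ∈ D.1 ∧ G.white (D.whiteEdge p).1 = p.1 ∧ (D.whiteEdge p).2.1 = p.2 :=
  (D.2.1 p.1 p.2).choose_spec.1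

theorem blackEdge_spec (D : G.DimerCover n) (p : Fin N × Fin n) :
    D.blackEdge p ∈ D.1 ∧ G.black (D.blackEdge p).1 = p.1 ∧ (D.blackEdge p).2.2 = p.2 :=
  (D.2.2 p.1 p.2).choose_spec.1

/-- The permutation of `Fin N × Fin n` (the labels of the vertices of the blow-up graph of either
color) which sends the label of a white vertex to the label of the black vertex matched to it. -/
noncomputable def perm (D : G.DimerCover n) : Equiv.Perm (Fin N × Fin n) where
  toFun p := (G.black (D.whiteEdge p).1, (D.whiteEdge p).2.2)
  invFun p := (G.white (D.blackEdge p).1, (D.blackEdge p).2.1)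
  left_inv p := by
    have h := D.whiteEdge_spec p
    have h' := D.blackEdge_spec (G.black (D.whiteEdge p).1, (D.whiteEdge p).2.2)
    have : D.blackEdge (G.black (D.whiteEdge p).1, (D.whiteEdge p).2.2) = D.whiteEdge p :=
      (D.2.2 (G.black (D.whiteEdge p).1) (D.whiteEdge p).2.2).unique h' ⟨h.1, rfl, rfl⟩
    simp only [this]
    exact Prod.ext h.2.1 h.2.2
  right_inv p := by
    have h := D.blackEdge_spec p
    have h' := D.whiteEdge_spec (G.white (D.blackEdge p).1, (D.blackEdge p).2.1)
    have : D.whiteEdge (G.white (D.blackEdge p).1, (D.blackEdge p).2.1) = D.blackEdge p :=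
      (D.2.1 (G.white (D.blackEdge p).1) (D.blackEdge p).2.1).unique h' ⟨h.1, rfl, rfl⟩
    simp only [this]
    exact Prod.ext h.2.1 h.2.2

/-- The multiplicity `m_e`: the number of edges of the dimer cover lying over `e`. -/
def mult [DecidableEq E] (D : G.DimerCover n) (e : E) : ℕ :=
  (D.1.filter fun x => x.1 = e).card

/-- The set `S_e` of colors on the white half-edge of `e`. -/
def whiteColors [DecidableEq E] (D : G.DimerCover n) (e : E) : Finset (Fin n) :=
  (D.1.filter fun x => x.1 = e).image fun x => x.2.1

/-- The set `T_e` of colors on the black half-edge of `e`. -/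
def blackColors [DecidableEq E] (D : G.DimerCover n) (e : E) : Finset (Fin n) :=
  (D.1.filter fun x => x.1 = e).image fun x => x.2.2

/-- The one-line notation of the vertex permutation at a black vertex: the colors on the half-edges
are listed in the order of the half-edges, those on one half-edge in increasing order. -/
def blackWord [DecidableEq E] (D : G.DimerCover n) (b : Fin N) : List (Fin n) :=
  (G.blackOrder b).flatMap fun e => (D.blackColors e).sort (· ≤ ·)

/-- The one-line notation of the vertex permutation at a white vertex. -/
def whiteWord [DecidableEq E] (D : G.DimerCover n) (w : Fin N) : List (Fin n) :=
  (G.whiteOrder w).flatMap fun e => (D.whiteColors e).sort (· ≤ ·)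

/-- The edge permutation `σ_e` in one-line notation, before the increasing relabelling of `T_e` by
`1, …, m_e` (which does not affect inversions): the elements `l` of `S_e` are read in increasing
order, and each is replaced by the element of `T_e` that is matched to it over `e`. -/
noncomputable def edgeWord [DecidableEq E] (D : G.DimerCover n) (e : E) : List (Fin n) :=
  ((D.whiteColors e).sort (· ≤ ·)).map fun l => (D.perm (G.white e, l)).2

end DimerCover

/-- The `q`-Kasteleyn determinant `Kdet_q(Φ)` for the signs `ε`: `q^(-N (n choose 2))` times the sum
over the dimer covers of the blow-up graph of
`(-1)^σ (∏_v q^ℓ(σ_v)) (∏_e q^(m_e choose 2) q^ℓ(σ_e)) (∏ ε)` times the ordered product of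
the entries of `Φ` along the dimers, taken in the lexicographic order of their white ends. -/
noncomputable def kasteleynDet [Fintype E] [DecidableEq E] {n : ℕ} {A : Type v} [Ring A]
    [Algebra ℂ A] (G : CiliatedGraph N E) (ε : E → ℤˣ) (q : ℂ)
    (Φ : E → Matrix (Fin n) (Fin n) A) : A :=
  q ^ (-((N * n.choose 2 : ℕ) : ℤ)) •
    ∑ D : G.DimerCover n,
      ((((Equiv.Perm.sign D.perm : ℤˣ) : ℤ) : ℂ) *
        ((∏ b, q ^ inversionCount (D.blackWord b)) * (∏ w, q ^ inversionCount (D.whiteWord w))) *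
        (∏ e, q ^ (D.mult e).choose 2 * q ^ inversionCount (D.edgeWord e)) *
        (∏ p : Fin N × Fin n, (((ε (D.whiteEdge p).1 : ℤˣ) : ℤ) : ℂ))) •
      (List.ofFn fun w : Fin N => (List.ofFn fun i : Fin n =>
        Φ (D.whiteEdge (w, i)).1 (D.whiteEdge (w, i)).2.1 (D.whiteEdge (w, i)).2.2).prod).prod

end CiliatedGraph

/-! In coordinates, the trace of a multiweb is a sum over colorings `β`, `ω` of the black and white
ends of the copies of the edges. Swapping an increasing pair of white colors on neighbouring copies
of one edge multiplies the white codeterminants by `-q`. Once the sum over `β` is taken, it also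
multiplies the entries by `-q`, by the row exchange rule for quantum 2×2 minors
(`quantum_exchange`). So colorings with the same sorted `ω` differ by powers of `q ^ 2`, their
inversion generating function is `q ^ (m_e choose 2) * [m_e]!` for each edge, and dividing by
`[m_e]!` leaves the `ω` that increase along every edge (`quantumTrace_eq_sum_strictMono`). The
nonzero terms that remain are the dimer covers with multiplicities `m` (`sum_dimerCover_eq`). Their
powers of `q` match those of the determinant, since the inversions of `β` split into those of the
edge permutations and those of the black vertex permutations (`sum_inversionCount_black`).

It remains to compare signs. The parity of the number of pairs on which two orderings disagree is a
cocycle (`discord_add_discord`). Comparing the orderings of the copies by white vertex and color,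
along the white lists, along the black lists, and by black vertex and color gives `(-1)^inversions =
sign(D.perm) * (-1)^crossing(m)`, where `crossing` is a quadratic form over `ZMod 2` in the
multiplicities alone (`neg_one_pow_inversions`).

Modulo 2 two multiwebs differ by a cycle, and by Euler's formula the boundaries of the internal
faces span the cycles (`range_boundaryMap`). Adding the boundary of a face with `l` sides and `k`
cilia changes `crossing` by `l/2 + 1 + k + n * k` (`crossing_add_faceBoundary`), which is the parity
prescribed by the Kasteleyn condition. Hence `(-1)^crossing(m) * ∏ ε^m` is the same for all
multiwebs, and this is the global sign (`exists_sign_crossing`). -/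

/-! ### Discordant pairs of two orderings -/

/-- Words along an ordered list: the inversions are the pairs discordant with the order. -/
theorem inversionCount_map_eq {X α : Type*} [LinearOrder α] {n : ℕ} (k : X → α)
    (ω : X → Fin n) (l : List X) (hl : l.Pairwise fun x y => k x < k y) [DecidableEq X] :
    (inversionCount (l.map ω) : ZMod 2) =
      ∑ x ∈ l.toFinset, ∑ y ∈ l.toFinset, if k x < k y ∧ ω y < ω x then 1 else 0 := by
  induction l with
  | nil => simp [inversionCount]
  | cons a l ih =>
    rw [List.pairwise_cons] at hl
    have ha : a ∉ l.toFinset := fun h => lt_irrefl _ (hl.1 a (by simpa using h))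
    have hnd : l.Nodup := hl.2.imp fun h H => by simp [H] at h
    rw [List.map_cons, inversionCount, List.toFinset_cons, Finset.sum_insert ha,
      Finset.sum_insert ha]
    have e1 : ∀ x ∈ l.toFinset, (∑ y ∈ insert a l.toFinset,
        if k x < k y ∧ ω y < ω x then 1 else 0 : ZMod 2) =
        ∑ y ∈ l.toFinset, if k x < k y ∧ ω y < ω x then 1 else 0 := by
      intro x hx
      rw [Finset.sum_insert ha, if_neg, zero_add]
      exact fun h => lt_asymm h.1 (hl.1 x (by simpa using hx))
    rw [Finset.sum_congr rfl e1, Nat.cast_add, ih hl.2]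
    simp only [lt_self_iff_false, false_and, if_false, zero_add]
    congr 1
    rw [List.countP_map, List.countP_eq_length_filter, ← List.toFinset_card_of_nodup
      (hnd.filter _), List.toFinset_filter, Finset.card_filter, Nat.cast_sum]
    refine Finset.sum_congr rfl fun y hy => ?_
    simp [hl.1 y (by simpa using hy)]

section Discord

variable {X Y α β γ : Type*} [Fintype X] [Fintype Y] [LinearOrder α] [LinearOrder β]
  [LinearOrder γ]

/-- The parity of the number of pairs which two keys put in opposite order. -/
def discord (k : X → α) (l : X → β) : ZMod 2 :=
  ∑ x, ∑ y, if k x < k y ∧ l y < l x then 1 else 0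

theorem discord_comm (k : X → α) (l : X → β) : discord k l = discord l k := by
  unfold discord
  rw [Finset.sum_comm]
  simp only [and_comm]

theorem discord_self (k : X → α) : discord k k = 0 := by
  unfold discord
  refine Finset.sum_eq_zero fun x _ => Finset.sum_eq_zero fun y _ => if_neg ?_
  exact fun h => lt_asymm h.1 h.2

theorem discord_comp_equiv (e : Y ≃ X) (k : X → α) (l : X → β) :
    discord (k ∘ e) (l ∘ e) = discord k l := by
  unfold discord
  rw [← e.sum_comp]
  refine Finset.sum_congr rfl fun x _ => ?_
  rw [← e.sum_comp]
  rfl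

/-- Folds a double sum onto the pairs increasing for `k`, so that identities between discordance
counts can be checked one unordered pair at a time. -/
theorem sum_sum_eq_sum_lt {M : Type*} [AddCommMonoid M] {k : X → α} (hk : Function.Injective k)
    (f : X → X → M) (hf : ∀ x, f x x = 0) :
    ∑ x, ∑ y, f x y = ∑ x, ∑ y, if k x < k y then f x y + f y x else 0 := by
  have h : ∀ x y, f x y = (if k x < k y then f x y else 0) + (if k y < k x then f x y else 0) := by
    intro x y
    rcases lt_trichotomy (k x) (k y) with h | h | h
    · simp [h, h.not_gt]
    · rw [hk h]; simp [hf]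
    · simp [h, h.not_gt]
  calc ∑ x, ∑ y, f x y
      = ∑ x, ∑ y, (if k x < k y then f x y else 0) +
          ∑ x, ∑ y, (if k y < k x then f x y else 0) := by
        simp only [← Finset.sum_add_distrib, ← h]
    _ = _ := by
        rw [Finset.sum_comm (f := fun x y => if k y < k x then f x y else 0)]
        simp only [← Finset.sum_add_distrib]
        refine Finset.sum_congr rfl fun x _ => Finset.sum_congr rfl fun y _ => ?_
        split_ifs <;> simp

/-- For a single pair, two orders either agree or disagree, and disagreement is additive modulo 2
along a chain of orders. -/
theorem discord_add_discord {k : X → α} {l : X → β} {h : X → γ} (hk : Function.Injective k)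
    (hl : Function.Injective l) (hh : Function.Injective h) :
    discord k l + discord l h = discord k h := by
  have e : discord l h =
      ∑ x, ∑ y, if k x < k y then ((if l x < l y ∧ h y < h x then 1 else 0) +
        if l y < l x ∧ h x < h y then 1 else 0 : ZMod 2) else 0 :=
    sum_sum_eq_sum_lt hk _ fun x => if_neg fun H => lt_irrefl _ H.1
  rw [e]
  unfold discord
  simp only [← Finset.sum_add_distrib]
  refine Finset.sum_congr rfl fun x _ => Finset.sum_congr rfl fun y _ => ?_
  by_cases hxy : k x < k y
  · have hne : x ≠ y := fun H => by simp [H] at hxy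
    rcases lt_or_gt_of_ne (hl.ne hne) with h1 | h1 <;>
      rcases lt_or_gt_of_ne (hh.ne hne) with h2 | h2 <;>
      simp [hxy, h1, h2, h1.not_gt, h2.not_gt]; decide
  · simp [hxy]

/-- An element strictly between `a` and `b` is discordant with both of them, so these pairs cancel
modulo 2 and only the pair `(a, b)` is left. -/
theorem discord_comp_swap [DecidableEq X] {k : X → α} {a b : X}
    (hab : k a < k b) : discord k (k ∘ Equiv.swap a b) = 1 := by
  have hne : a ≠ b := fun H => by simp [H] at hab
  -- count the discordant pairs by whether they meet `{a, b}`
  have key : ∀ x y,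
      (if k x < k y ∧ k (Equiv.swap a b y) < k (Equiv.swap a b x) then 1 else 0 : ZMod 2) =
        (if x = a ∧ y = b then 1 else 0) + (if y = b ∧ k a < k x ∧ k x < k b then 1 else 0)
        + (if x = a ∧ k a < k y ∧ k y < k b then 1 else 0) := by
    intro x y
    by_cases hxa : x = a
    · subst hxa
      by_cases hyb : y = b
      · subst hyb; simp [hab]
      · by_cases hyx : y = x
        · subst hyx; simp
          intro; simp_all
        · rw [Equiv.swap_apply_left, Equiv.swap_apply_of_ne_of_ne hyx hyb]
          simp [hyb]
    · by_cases hyb : y = b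
      · subst hyb
        by_cases hxb : x = y
        · subst hxb; simp [hxa]
        · rw [Equiv.swap_apply_right, Equiv.swap_apply_of_ne_of_ne hxa hxb]
          simp [hxa, and_comm]
      · by_cases hxb : x = b
        · subst hxb
          by_cases hya : y = a
          · subst hya; simp [hxa, hyb, hab.not_gt]
          · rw [Equiv.swap_apply_right, Equiv.swap_apply_of_ne_of_ne hya hyb]
            simp [hyb, hxa]
            intro h1; exact (hab.trans h1).le
        · rw [Equiv.swap_apply_of_ne_of_ne hxa hxb]
          by_cases hya : y = a
          · subst hya
            rw [Equiv.swap_apply_left]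
            simp [hxa, hyb]
            intro h1; exact (h1.trans hab).le
          · rw [Equiv.swap_apply_of_ne_of_ne hya hyb]
            simp [hxa, hyb]
            intro h1; exact h1.le
  unfold discord
  simp only [Function.comp_apply, key, Finset.sum_add_distrib]
  have e1 : (∑ x, ∑ y, if x = a ∧ y = b then 1 else 0 : ZMod 2) = 1 := by
    simp [ite_and]
  have e2 : (∑ x, ∑ y, if y = b ∧ k a < k x ∧ k x < k b then 1 else 0 : ZMod 2) =
      ∑ x, if k a < k x ∧ k x < k b then 1 else 0 := by
    refine Finset.sum_congr rfl fun x _ => ?_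
    simp only [ite_and]
    simp
  have e3 : (∑ x, ∑ y, if x = a ∧ k a < k y ∧ k y < k b then 1 else 0 : ZMod 2) =
      ∑ x, if k a < k x ∧ k x < k b then 1 else 0 := by
    rw [Finset.sum_comm]
    refine Finset.sum_congr rfl fun x _ => ?_
    simp only [ite_and]
    simp
  rw [e1, e2, e3, add_assoc, CharTwo.add_self_eq_zero, add_zero]

/-- By the cocycle rule and invariance under reindexing, the right side is multiplicative in `π`; on
transpositions it is `-1`. -/
theorem sign_eq_discord [DecidableEq X] {k : X → α} (hk : Function.Injective k)
    (π : Equiv.Perm X) : Equiv.Perm.sign π = (-1 : ℤˣ) ^ discord k (k ∘ π) := by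
  induction π using Equiv.Perm.swap_induction_on with
  | one => simp [discord_self]
  | swap_mul f x y hxy ih =>
    have h1 : discord k (k ∘ ⇑(Equiv.swap x y * f)) =
        discord k (k ∘ Equiv.swap x y) + discord k (k ∘ f) := by
      have h := discord_add_discord (k := k) (l := k ∘ f) (h := k ∘ ⇑(Equiv.swap x y * f)) hk
        (hk.comp f.injective) (hk.comp (Equiv.swap x y * f).injective)
      have h2 := discord_comp_equiv f k (k ∘ Equiv.swap x y)
      rw [← h, ← h2, add_comm]
      rfl
    have h2 : discord k (k ∘ Equiv.swap x y) = 1 := by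
      rcases lt_or_gt_of_ne (hk.ne hxy) with h | h
      · exact discord_comp_swap h
      · rw [Equiv.swap_comm]; exact discord_comp_swap h
    rw [Equiv.Perm.sign_mul, Equiv.Perm.sign_swap hxy, ih, h1, h2, uzpow_add, uzpow_one]

/-- Both keys refine the order of the vertices, so pairs at different vertices are never discordant
and only inversions within one list count. -/
theorem sum_inversionCount_eq_discord [DecidableEq X] {N n : ℕ} (v : X → Fin N)
    (L : Fin N → List X) (hL : ∀ w x, x ∈ L w ↔ v x = w) (k : X → α)
    (hk : ∀ w, (L w).Pairwise fun x y => k x < k y) (hvk : ∀ x y, v x < v y → k x < k y)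
    (ω : X → Fin n) :
    ((∑ w, inversionCount ((L w).map ω) : ℕ) : ZMod 2) =
      discord k fun x => toLex (v x, ω x) := by
  rw [Nat.cast_sum]
  have h : ∀ w, (inversionCount ((L w).map ω) : ZMod 2) =
      ∑ x, if v x = w then ∑ y, (if v y = w then (if k x < k y ∧ ω y < ω x then 1 else 0) else 0)
        else 0 := by
    intro w
    rw [inversionCount_map_eq k ω _ (hk w)]
    have : (L w).toFinset = Finset.univ.filter fun x => v x = w := by ext x; simp [hL]
    rw [this, Finset.sum_filter]
    refine Finset.sum_congr rfl fun x _ => ?_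
    rw [Finset.sum_filter]
  simp only [h]
  rw [Finset.sum_comm]
  unfold discord
  refine Finset.sum_congr rfl fun x _ => ?_
  simp only [Finset.sum_ite_eq, Finset.mem_univ, if_true]
  refine Finset.sum_congr rfl fun y _ => ?_
  rw [← ite_and]
  refine if_congr ?_ rfl rfl
  rw [Prod.Lex.toLex_lt_toLex]
  constructor
  · rintro ⟨h1, h2, h3⟩; exact ⟨h2, Or.inr ⟨h1, h3⟩⟩
  · rintro ⟨h2, h1 | ⟨h1, h3⟩⟩
    · exact absurd (hvk _ _ h1) h2.not_gt
    · exact ⟨h1, h2, h3⟩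

end Discord

/-! ### Signs written as powers of -1 with exponents in `ZMod 2`. -/

theorem neg_one_uzpow_injective : Function.Injective fun x : ZMod 2 => (-1 : ℤˣ) ^ x := by
  decide

theorem exists_neg_one_uzpow (u : ℤˣ) : ∃ x : ZMod 2, (-1 : ℤˣ) ^ x = u := by
  revert u; decide

theorem uzpow_sum {ι : Type*} (s : Finset ι) (f : ι → ZMod 2) (u : ℤˣ) :
    u ^ (∑ i ∈ s, f i) = ∏ i ∈ s, u ^ f i := by
  classical
  induction s using Finset.induction_on with
  | empty => simp
  | insert a s ha ih => rw [Finset.sum_insert ha, Finset.prod_insert ha, uzpow_add, ih]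

/-! ### The crossing form of two orderings -/

section CrossingForm

variable {X Y α β : Type*} [Fintype Y] [LinearOrder α] [LinearOrder β]

/-- The number of preimages under `j`, modulo `2`. -/
def fiberCount [DecidableEq X] (j : Y → X) (x : X) : ZMod 2 := ∑ y, if j y = x then 1 else 0

theorem fiberCount_comp_equiv [DecidableEq X] (e : Y ≃ Y) (j : Y → X) :
    fiberCount (j ∘ e) = fiberCount j := by
  funext x
  exact e.sum_comp fun y => if j y = x then (1 : ZMod 2) else 0

variable [Fintype X]

/-- The quadratic form over `ZMod 2` which counts the discordant pairs with multiplicities. -/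
def crossingForm (k : X → α) (l : X → β) (m : X → ZMod 2) : ZMod 2 :=
  ∑ x, ∑ y, m x * m y * if k x < k y ∧ l y < l x then 1 else 0

/-- The last sum is the polar form: the two comparisons add up to 1 modulo 2 exactly when `x` and
`y` are discordant. In this shape each order can be treated separately. -/
theorem crossingForm_add {k : X → α} {l : X → β} (hk : Function.Injective k)
    (hl : Function.Injective l) (m c : X → ZMod 2) :
    crossingForm k l (m + c) = crossingForm k l m + crossingForm k l c +
      ∑ y, c y * ∑ x, m x * ((if k x < k y then 1 else 0) + if l x < l y then 1 else 0) := by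
  unfold crossingForm
  have h : ∀ x y, (if k x < k y then 1 else 0 : ZMod 2) + (if l x < l y then 1 else 0) =
      (if k x < k y ∧ l y < l x then 1 else 0) + if k y < k x ∧ l x < l y then 1 else 0 := by
    intro x y
    by_cases hxy : x = y
    · subst hxy; simp
    · rcases lt_or_gt_of_ne (hk.ne hxy) with h1 | h1 <;>
        rcases lt_or_gt_of_ne (hl.ne hxy) with h2 | h2 <;>
        simp [h1, h2, h1.not_gt, h2.not_gt]; decide
  simp only [h, Finset.mul_sum, mul_add, Finset.sum_add_distrib]
  rw [Finset.sum_comm (f := fun x y => c x * (m y * if k y < k x ∧ l x < l y then 1 else 0))]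
  simp only [← Finset.sum_add_distrib]
  refine Finset.sum_congr rfl fun x _ => Finset.sum_congr rfl fun y _ => ?_
  simp only [Pi.add_apply]
  ring

variable [DecidableEq X]

theorem sum_fiberCount_mul (j : Y → X) (h : X → ZMod 2) :
    ∑ x, fiberCount j x * h x = ∑ y, h (j y) := by
  unfold fiberCount
  simp only [Finset.sum_mul]
  rw [Finset.sum_comm]
  simp

theorem crossingForm_fiberCount (k : X → α) (l : X → β) (j : Y → X) :
    crossingForm k l (fiberCount j) = discord (k ∘ j) (l ∘ j) := by
  unfold crossingForm discord
  simp only [mul_assoc, ← Finset.mul_sum, sum_fiberCount_mul]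
  rfl

end CrossingForm

/-! ### Cyclic successors -/

section CyclicSucc

variable {X α ι : Type*} [LinearOrder α] [LinearOrder ι]

/-- `φ` is the cyclic successor, inside the fibers of `v`, for the order given by the key `k`, which
refines the order of the values of `v`; the last elements of the fibers satisfy `last`. -/
structure IsCyclicSucc (v : X → ι) (k : X → α) (last : X → Prop) (φ : X → X) : Prop where
  injective : Function.Injective k
  lt_of_lt : ∀ g e, v g < v e → k g < k e
  vertex : ∀ e, v (φ e) = v e
  lt_iff_of_not_last : ∀ e, ¬ last e → ∀ g, k g < k (φ e) ↔ k g ≤ k e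
  lt_iff_of_last : ∀ e, last e → ∀ g, k g < k (φ e) ↔ v g < v e
  le_of_last : ∀ e, last e → ∀ g, v g = v e → k g ≤ k e

namespace IsCyclicSucc

variable {v : X → ι} {k : X → α} {last : X → Prop} {φ : X → X}

theorem le_of_le (h : IsCyclicSucc v k last φ) {g e : X} (hge : k g ≤ k e) : v g ≤ v e :=
  not_lt.1 fun H => hge.not_gt (h.lt_of_lt _ _ H)

/-- The predecessors of `e` and of `φ e` differ by `e` alone, unless `e` is last. Then `φ e` is the
first element of the fiber, and they differ by the whole fiber without `e`. -/
theorem sum_mul_lt [Fintype X] [DecidablePred last] (h : IsCyclicSucc v k last φ)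
    (m : X → ZMod 2) (e : X) :
    ∑ g, m g * ((if k g < k e then 1 else 0) + if k g < k (φ e) then 1 else 0) =
      m e + if last e then ∑ g ∈ Finset.univ.filter (fun g => v g = v e), m g else 0 := by
  classical
  have hm : m e = ∑ g, m g * if g = e then 1 else 0 := by simp
  rw [hm]
  by_cases he : last e
  · rw [if_pos he, Finset.sum_filter, ← Finset.sum_add_distrib]
    refine Finset.sum_congr rfl fun g _ => ?_
    simp only [h.lt_iff_of_last e he g]
    by_cases hge : g = e
    · subst hge; simp
      generalize m g = x; revert x; decide
    · rcases lt_trichotomy (v g) (v e) with H | H | H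
      · simp [hge, H, H.ne, h.lt_of_lt _ _ H, CharTwo.add_self_eq_zero]
      · simp [hge, H, lt_of_le_of_ne (h.le_of_last e he g H) (h.injective.ne hge)]
      · simp [hge, H.not_gt, H.ne', (h.lt_of_lt _ _ H).not_gt]
  · rw [if_neg he, add_zero]
    refine Finset.sum_congr rfl fun g _ => ?_
    simp only [h.lt_iff_of_not_last e he g]
    by_cases hge : g = e
    · subst hge; simp
    · have := h.injective.ne hge
      rcases lt_or_gt_of_ne this with H | H
      · simp [hge, H, H.le, CharTwo.add_self_eq_zero]
      · simp [hge, H.not_gt, H.not_ge]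

/-- Each unordered pair of distinct elements contributes 1 and each diagonal term contributes 1,
corrected by 1 at the last elements; the total is `F.card.choose 2 + F.card` plus the number of last
elements. -/
theorem discord_add_sum (h : IsCyclicSucc v k last φ) [DecidablePred last] (F : Finset X) :
    discord (k ∘ φ ∘ ((↑) : F → X)) (k ∘ ((↑) : F → X)) +
      ∑ e : F, ∑ g : F, (if k e < k (φ g) then 1 else 0) =
      (((F.card + 1).choose 2 + (F.filter last).card : ℕ) : ZMod 2) := by
  classical
  have hk : Function.Injective (k ∘ ((↑) : F → X)) := h.injective.comp Subtype.val_injective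
  have hdiag : ∀ e, (if k e < k (φ e) then 1 else 0 : ZMod 2) = 1 + if last e then 1 else 0 := by
    intro e
    by_cases he : last e
    · simp [he, h.lt_iff_of_last e he e]; decide
    · simp [he, h.lt_iff_of_not_last e he e]
  -- Exactly one of the three events occurs; which one depends on whether the successors wrap around
  -- past the cilium.
  have hoff : ∀ e g, k e < k g → ((if k (φ g) < k (φ e) then 1 else 0) +
      ((if k e < k (φ g) then 1 else 0) + if k g < k (φ e) then 1 else 0) : ZMod 2) = 1 := by
    intro e g heg
    by_cases he : last e <;> by_cases hg : last g
    · have h1 : v e < v g := lt_of_le_of_ne (h.le_of_le heg.le) fun H =>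
        (h.le_of_last e he g H.symm).not_gt heg
      simp [h.lt_iff_of_last e he, h.lt_iff_of_last g hg, h.vertex, h1, h1.not_gt]
    · have h1 := (h.le_of_le heg.le).not_gt
      simp [h.lt_iff_of_last e he, h.lt_iff_of_not_last g hg, h.vertex, h1, heg.le]
    · have h2 : k (φ g) < k (φ e) ↔ ¬ k e < k (φ g) := by
        rw [h.lt_iff_of_not_last e he, not_lt]
      have h3 : ¬ k g < k (φ e) := by
        rw [h.lt_iff_of_not_last e he]; exact heg.not_ge
      by_cases h4 : k e < k (φ g) <;> simp [h2, h3, h4]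
    · have h2 : k (φ g) < k (φ e) ↔ ¬ k e < k (φ g) := by
        rw [h.lt_iff_of_not_last e he, not_lt]
      have h3 : ¬ k g < k (φ e) := by
        rw [h.lt_iff_of_not_last e he]; exact heg.not_ge
      by_cases h4 : k e < k (φ g) <;> simp [h2, h3, h4]
  have hsplit : ∑ e : F, ∑ g : F, (if k e < k (φ g) then 1 else 0 : ZMod 2) =
      ∑ e : F, (if k e < k (φ e) then 1 else 0) +
        ∑ e : F, ∑ g : F, if e = g then 0 else if k e < k (φ g) then 1 else 0 := by
    rw [← Finset.sum_add_distrib]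
    refine Finset.sum_congr rfl fun e _ => ?_
    have : ∀ g : F, (if k e < k (φ g) then 1 else 0 : ZMod 2) =
        (if e = g then (if k e < k (φ g) then 1 else 0) else 0) +
          if e = g then 0 else if k e < k (φ g) then 1 else 0 := by
      intro g; by_cases H : e = g <;> simp [H]
    rw [Finset.sum_congr rfl fun g _ => this g, Finset.sum_add_distrib, Finset.sum_ite_eq]
    simp
  have hpairs : ∑ e : F, ∑ g : F, (if k e < k g then 1 else 0 : ZMod 2) =
      ((F.card.choose 2 : ℕ) : ZMod 2) := by
    have h1 : ∑ e : F, ∑ g : F, (if k e < k g then 1 else 0 : ℕ) = F.card.choose 2 := by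
      have h2 := sum_sum_eq_sum_lt hk (fun e g : F => if e = g then (0 : ℕ) else 1) (by simp)
      have h3 : ∑ e : F, ∑ g : F, (if e = g then (0 : ℕ) else 1) = F.card * (F.card - 1) := by
        simp [Finset.sum_ite, Finset.filter_ne, Finset.card_erase_of_mem]
      rw [h3] at h2
      have h4 : ∀ e g : F, (if (k ∘ ((↑) : F → X)) e < (k ∘ ((↑) : F → X)) g then
          (if e = g then 0 else 1) + (if g = e then 0 else 1) else 0 : ℕ) =
          2 * if k e < k g then 1 else 0 := by
        intro e g
        by_cases H : k e < k g
        · have : e ≠ g := fun h => by simp [h] at H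
          simp [H, this, this.symm]
        · simp [H]
      simp only [h4, ← Finset.mul_sum] at h2
      rw [Nat.choose_two_right]
      omega
    exact_mod_cast congrArg (Nat.cast : ℕ → ZMod 2) h1
  rw [hsplit, sum_sum_eq_sum_lt hk (fun e g => if e = g then 0 else
    if k e < k (φ g) then 1 else 0) (by simp), discord_comm, discord]
  rw [add_left_comm, ← Finset.sum_add_distrib]
  simp only [← Finset.sum_add_distrib]
  have : ∀ e g : F, ((if (k ∘ ((↑) : F → X)) e < (k ∘ ((↑) : F → X)) g ∧
      (k ∘ φ ∘ ((↑) : F → X)) g < (k ∘ φ ∘ ((↑) : F → X)) e then 1 else 0) +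
      if (k ∘ ((↑) : F → X)) e < (k ∘ ((↑) : F → X)) g then
        ((if e = g then 0 else if k e < k (φ g) then 1 else 0) +
          if g = e then 0 else if k g < k (φ e) then 1 else 0) else 0 : ZMod 2) =
      if k e < k g then 1 else 0 := by
    intro e g
    by_cases H : k e < k g
    · have hne : e ≠ g := fun h => by simp [h] at H
      simp only [Function.comp_apply, H, true_and, hne, hne.symm, if_false, if_true]
      exact hoff e g H
    · simp [H]
  simp only [this, hpairs, hdiag, Finset.sum_add_distrib]
  rw [show (F.card + 1).choose 2 = F.card.choose 1 + F.card.choose 2 from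
    Nat.choose_succ_succ' F.card 1]
  simp only [Finset.sum_const, Finset.card_univ, Fintype.card_coe, Nat.cast_add,
    Nat.choose_one_right, nsmul_eq_mul, mul_one, Finset.card_filter, Nat.cast_sum]
  have : ∑ x : F, (if last (x : X) then 1 else 0 : ZMod 2) =
      ∑ x ∈ F, ((if last x then 1 else 0 : ℕ) : ZMod 2) := by
    rw [← Finset.sum_coe_sort F]
    exact Finset.sum_congr rfl fun x _ => by split_ifs <;> simp
  rw [this]
  ring

end IsCyclicSucc

end CyclicSucc

/-! ### Positions in the vertex lists as keys, with `formPerm` as cyclic successor. -/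

section VertexKey

variable {E : Type*} [DecidableEq E] {N : ℕ}

/-- The position of an edge at its end, the vertices being taken one after the other. -/
def vertexKey (v : E → Fin N) (L : Fin N → List E) (e : E) : Fin N ×ₗ ℕ :=
  toLex (v e, (L (v e)).idxOf e)

variable {v : E → Fin N} {L : Fin N → List E}

theorem vertexKey_lt_of_lt (g e : E) (h : v g < v e) : vertexKey v L g < vertexKey v L e := by
  rw [vertexKey, vertexKey, Prod.Lex.toLex_lt_toLex]
  exact Or.inl h

theorem vertexKey_injective (hL : ∀ w x, x ∈ L w ↔ v x = w) :
    Function.Injective (vertexKey v L) := by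
  intro x y h
  have h' := Prod.ext_iff.1 (toLex.injective h)
  simp only at h'
  obtain ⟨h1, h2⟩ := h'
  rw [h1] at h2
  exact List.idxOf_inj ((hL _ _).2 h1) |>.1 h2

theorem pairwise_vertexKey (hL : ∀ w x, x ∈ L w ↔ v x = w) (hn : ∀ w, (L w).Nodup) (w : Fin N) :
    (L w).Pairwise fun x y => vertexKey v L x < vertexKey v L y := by
  rw [List.pairwise_iff_getElem]
  intro i j hi hj hij
  have h1 : v (L w)[i] = w := (hL _ _).1 (List.getElem_mem hi)
  have h2 : v (L w)[j] = w := (hL _ _).1 (List.getElem_mem hj)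
  rw [vertexKey, vertexKey, Prod.Lex.toLex_lt_toLex]
  right
  refine ⟨h1.trans h2.symm, ?_⟩
  simp only [h1, h2, (hn w).idxOf_getElem]
  exact hij

/-- `formPerm` raises the index by 1 modulo the length of the list, so it returns to index 0 exactly
at the last entry. -/
theorem isCyclicSucc_formPerm (hL : ∀ w x, x ∈ L w ↔ v x = w) (hn : ∀ w, (L w).Nodup) :
    IsCyclicSucc v (vertexKey v L) (fun e => (L (v e)).getLast? = some e)
      (fun e => (L (v e)).formPerm e) := by
  have hv : ∀ e, v ((L (v e)).formPerm e) = v e := fun e => by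
    rw [← hL, List.formPerm_mem_iff_mem, hL]
  have hi : ∀ e, (L (v e)).idxOf e < (L (v e)).length := fun e =>
    List.idxOf_lt_length_of_mem ((hL _ _).2 rfl)
  have hlast : ∀ e, (L (v e)).getLast? = some e ↔
      (L (v e)).idxOf e + 1 = (L (v e)).length := by
    intro e
    have h0 := hi e
    rw [List.getLast?_eq_getElem?]
    constructor
    · intro h
      obtain ⟨h1, h2⟩ := List.getElem?_eq_some_iff.1 h
      have := (hn (v e)).idxOf_getElem _ h1
      rw [h2] at this
      omega
    · intro h
      rw [show (L (v e)).length - 1 = (L (v e)).idxOf e by omega,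
        List.getElem?_eq_some_iff]
      exact ⟨h0, List.getElem_idxOf h0⟩
  have hidx : ∀ e, (L (v e)).idxOf ((L (v e)).formPerm e) =
      ((L (v e)).idxOf e + 1) % (L (v e)).length := by
    intro e
    have := List.formPerm_apply_getElem _ (hn (v e)) _ (hi e)
    rw [List.getElem_idxOf (hi e)] at this
    rw [this, (hn (v e)).idxOf_getElem]
  refine ⟨vertexKey_injective hL, vertexKey_lt_of_lt, hv, ?_, ?_, ?_⟩
  · intro e he g
    rw [hlast] at he
    have h0 := hi e
    have h1 := hidx e
    rw [Nat.mod_eq_of_lt (by omega)] at h1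
    simp only [vertexKey, hv, Prod.Lex.toLex_lt_toLex, Prod.Lex.toLex_le_toLex, h1, Nat.lt_succ_iff]
  · intro e he g
    rw [hlast] at he
    have h1 := hidx e
    rw [he, Nat.mod_self] at h1
    simp [vertexKey, hv, Prod.Lex.toLex_lt_toLex, h1]
  · intro e he g hg
    rw [hlast] at he
    rw [vertexKey, vertexKey, Prod.Lex.toLex_le_toLex]
    right
    refine ⟨hg, ?_⟩
    have := hi g
    rw [hg] at this
    simp only [hg]
    omega

end VertexKey

namespace CiliatedGraph

variable {N : ℕ} {E : Type u} [DecidableEq E]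

/-! ### The crossing form of a ciliated graph -/

/-- The order of the edges along the lists of the white vertices. -/
def whiteKey (G : CiliatedGraph N E) : E → Fin N ×ₗ ℕ := vertexKey G.white G.whiteOrder

/-- The order of the edges along the lists of the black vertices. -/
def blackKey (G : CiliatedGraph N E) : E → Fin N ×ₗ ℕ := vertexKey G.black G.blackOrder

theorem isCyclicSucc_nextWhite (G : CiliatedGraph N E) :
    IsCyclicSucc G.white G.whiteKey (fun e => (G.whiteOrder (G.white e)).getLast? = some e)
      G.nextWhite :=
  isCyclicSucc_formPerm G.mem_whiteOrder G.nodup_whiteOrder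

theorem isCyclicSucc_nextBlack (G : CiliatedGraph N E) :
    IsCyclicSucc G.black G.blackKey (fun e => (G.blackOrder (G.black e)).getLast? = some e)
      G.nextBlack :=
  isCyclicSucc_formPerm G.mem_blackOrder G.nodup_blackOrder

theorem leftFace_faceStep (G : CiliatedGraph N E) (e : E) :
    G.leftFace (G.faceStep e) = G.leftFace e :=
  Quotient.sound (Equiv.Perm.sameCycle_apply_left.2 (Equiv.Perm.SameCycle.refl _ _))

theorem nextBlack_faceStep (G : CiliatedGraph N E) (e : E) :
    G.nextBlack (G.faceStep e) = G.nextWhite e := by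
  simp [faceStep]

variable [Fintype E]

theorem mem_faceEdges (G : CiliatedGraph N E) (f : G.Face) (e : E) :
    e ∈ G.faceEdges f ↔ G.leftFace e = f := by
  simp [faceEdges]

theorem faceEdges_nonempty (G : CiliatedGraph N E) (f : G.Face) : (G.faceEdges f).Nonempty := by
  obtain ⟨e, rfl⟩ := Quotient.exists_rep f
  exact ⟨e, (G.mem_faceEdges _ _).2 rfl⟩

/-- The cyclic permutation `faceStep` of the edges of one face. -/
def faceStepOn (G : CiliatedGraph N E) (f : G.Face) : Equiv.Perm (G.faceEdges f) :=
  G.faceStep.subtypePerm fun e => by rw [mem_faceEdges, mem_faceEdges, leftFace_faceStep]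

/-- A face is a single orbit of `faceStep`. A one-edge face is separate, since the identity does not
count as a cycle. -/
theorem sign_faceStepOn (G : CiliatedGraph N E) (f : G.Face) :
    Equiv.Perm.sign (G.faceStepOn f) = (-1) ^ ((G.faceEdges f).card + 1) := by
  by_cases h1 : Nontrivial (G.faceEdges f)
  · have hon : (G.faceStepOn f).IsCycleOn Set.univ := by
      refine ⟨(G.faceStepOn f).bijective.bijOn_univ, fun x _ y _ => ?_⟩
      have hxy : G.faceStep.SameCycle x y :=
        Quotient.exact (((G.mem_faceEdges f _).1 x.2).trans ((G.mem_faceEdges f _).1 y.2).symm)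
      obtain ⟨i, hi⟩ := hxy
      exact ⟨i, Subtype.ext (by rw [faceStepOn, Equiv.Perm.subtypePerm_zpow]; exact hi)⟩
    have hcyc : (G.faceStepOn f).IsCycle := Equiv.Perm.isCycle_iff_exists_isCycleOn.2
      ⟨Set.univ, Set.nontrivial_univ, hon, fun _ _ => Set.mem_univ _⟩
    have hsupp : (G.faceStepOn f).support = Finset.univ := by
      ext x
      simpa using hon.apply_ne Set.nontrivial_univ (Set.mem_univ x)
    rw [hcyc.sign, hsupp, Finset.card_univ, Fintype.card_coe, pow_succ]
    simp
  · rw [not_nontrivial_iff_subsingleton] at h1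
    have h2 : (G.faceEdges f).card = 1 := by
      have h3 := Fintype.card_le_one_iff_subsingleton.2 h1
      rw [Fintype.card_coe] at h3
      exact le_antisymm h3 (G.faceEdges_nonempty f).card_pos
    rw [h2, Subsingleton.elim (G.faceStepOn f) 1]
    simp

/-- The number of times, modulo `2`, that the boundary of a face traverses an edge. -/
noncomputable def faceBoundary (G : CiliatedGraph N E) (f : G.Face) : E → ZMod 2 :=
  fiberCount ((↑) : G.faceEdges f → E) + fiberCount (G.nextWhite ∘ ((↑) : G.faceEdges f → E))

/-- Since `nextBlack ∘ faceStep = nextWhite` and `faceStep` permutes the edges of the face, the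
sides traversed from white to black can be read off at either end. This makes the white and the
black order play symmetric roles. -/
theorem fiberCount_nextWhite (G : CiliatedGraph N E) (f : G.Face) :
    fiberCount (G.nextWhite ∘ ((↑) : G.faceEdges f → E)) =
      fiberCount (G.nextBlack ∘ ((↑) : G.faceEdges f → E)) := by
  rw [← fiberCount_comp_equiv (G.faceStepOn f) (G.nextBlack ∘ ((↑) : G.faceEdges f → E))]
  congr 1
  funext e
  exact (G.nextBlack_faceStep e).symm

theorem sum_faceBoundary_mul (G : CiliatedGraph N E) (f : G.Face) (h : E → ZMod 2) :
    ∑ x, G.faceBoundary f x * h x = ∑ e : G.faceEdges f, (h e + h (G.nextWhite e)) := by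
  simp only [faceBoundary, Pi.add_apply, add_mul, Finset.sum_add_distrib, sum_fiberCount_mul]
  rfl

theorem sum_faceBoundary_mul' (G : CiliatedGraph N E) (f : G.Face) (h : E → ZMod 2) :
    ∑ x, G.faceBoundary f x * h x = ∑ e : G.faceEdges f, (h e + h (G.nextBlack e)) := by
  rw [faceBoundary, fiberCount_nextWhite]
  simp only [Pi.add_apply, add_mul, Finset.sum_add_distrib, sum_fiberCount_mul]
  rfl

/-- The quadratic form counting the crossings between the black and the white order. -/
def crossing (G : CiliatedGraph N E) (m : E → ZMod 2) : ZMod 2 :=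
  crossingForm G.whiteKey G.blackKey m

/-- The form is expanded on the two halves of the boundary. The polar part joins with discordances
between an edge and its successor, so that `discord_add_sum` yields the cilia at each color, and the
remaining term is the sign of the cycle `faceStepOn f`. -/
theorem crossing_faceBoundary (G : CiliatedGraph N E) (f : G.Face) :
    G.crossing (G.faceBoundary f) = ((G.faceEdges f).card + 1 + G.ciliaCount f : ℕ) := by
  classical
  have hW := G.isCyclicSucc_nextWhite
  have hB := G.isCyclicSucc_nextBlack
  set ι : G.faceEdges f → E := (↑) with hι
  have hιi : Function.Injective ι := Subtype.val_injective
  have hWφ : Function.Injective (G.whiteKey ∘ G.nextWhite ∘ ι) :=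
    hW.injective.comp (G.nextWhite.injective.comp hιi)
  have hBφ : Function.Injective (G.blackKey ∘ G.nextWhite ∘ ι) :=
    hB.injective.comp (G.nextWhite.injective.comp hιi)
  have hBψ : Function.Injective (G.blackKey ∘ G.nextBlack ∘ ι) :=
    hB.injective.comp (G.nextBlack.injective.comp hιi)
  have hWι : Function.Injective (G.whiteKey ∘ ι) := hW.injective.comp hιi
  have hBι : Function.Injective (G.blackKey ∘ ι) := hB.injective.comp hιi
  have hcross : ∑ y, fiberCount (G.nextWhite ∘ ι) y * ∑ x, fiberCount ι x *
      ((if G.whiteKey x < G.whiteKey y then 1 else 0) +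
        if G.blackKey x < G.blackKey y then 1 else 0) =
      (∑ e : G.faceEdges f, ∑ g : G.faceEdges f,
        if G.whiteKey e < G.whiteKey (G.nextWhite g) then 1 else 0) +
      ∑ e : G.faceEdges f, ∑ g : G.faceEdges f,
        if G.blackKey e < G.blackKey (G.nextBlack g) then 1 else 0 := by
    simp only [mul_add, Finset.sum_add_distrib]
    congr 1
    · simp only [sum_fiberCount_mul]
      rw [Finset.sum_comm]
      rfl
    · rw [fiberCount_nextWhite]
      simp only [sum_fiberCount_mul]
      rw [Finset.sum_comm]
      rfl
  have hsign : discord (G.blackKey ∘ G.nextBlack ∘ ι) (G.blackKey ∘ G.nextWhite ∘ ι) =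
      (((G.faceEdges f).card + 1 : ℕ) : ZMod 2) := by
    apply neg_one_uzpow_injective
    have h1 := sign_eq_discord hBψ (G.faceStepOn f)
    have h2 : (G.blackKey ∘ G.nextBlack ∘ ι) ∘ G.faceStepOn f =
        G.blackKey ∘ G.nextWhite ∘ ι := by
      funext e
      exact congrArg G.blackKey (G.nextBlack_faceStep e)
    rw [h2, sign_faceStepOn] at h1
    exact h1.symm.trans (uzpow_natCast _ _).symm
  rw [crossing, faceBoundary, crossingForm_add hW.injective hB.injective, hcross,
    crossingForm_fiberCount, crossingForm_fiberCount]
  have e1 := hW.discord_add_sum (G.faceEdges f)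
  have e2 := hB.discord_add_sum (G.faceEdges f)
  -- The cocycle rule along a chain of five orderings; the middle term cancels the crossing form of
  -- the first half of the boundary.
  have e3 : discord (G.whiteKey ∘ G.nextWhite ∘ ι) (G.blackKey ∘ G.nextWhite ∘ ι) =
      discord (G.whiteKey ∘ G.nextWhite ∘ ι) (G.whiteKey ∘ ι) +
        discord (G.whiteKey ∘ ι) (G.blackKey ∘ ι) +
        discord (G.blackKey ∘ G.nextBlack ∘ ι) (G.blackKey ∘ ι) +
        discord (G.blackKey ∘ G.nextBlack ∘ ι) (G.blackKey ∘ G.nextWhite ∘ ι) := by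
    rw [discord_add_discord hWφ hWι hBι,
      discord_comm (G.blackKey ∘ G.nextBlack ∘ ι) (G.blackKey ∘ ι),
      discord_add_discord hWφ hBι hBψ, discord_add_discord hWφ hBψ hBφ]
  rw [e3, hsign, ciliaCount]
  push_cast at e1 e2 ⊢
  linear_combination (exp := 1) e1 + e2 +
    CharTwo.add_self_eq_zero (discord (G.whiteKey ∘ ι) (G.blackKey ∘ ι)) +
    CharTwo.add_self_eq_zero ((((G.faceEdges f).card + 1).choose 2 : ℕ) : ZMod 2)

/-- In the polar form each corner contributes `m e`, which occurs once for white and once for black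
and cancels, and a corner with a cilium contributes in addition the vertex sum `n`. -/
theorem crossing_add_faceBoundary (G : CiliatedGraph N E) (f : G.Face) (n : ℕ)
    (m : E → ZMod 2) (hb : ∀ b, ∑ e ∈ Finset.univ.filter (fun e => G.black e = b), m e = n)
    (hw : ∀ w, ∑ e ∈ Finset.univ.filter (fun e => G.white e = w), m e = n) :
    G.crossing (m + G.faceBoundary f) =
      G.crossing m + ((G.faceEdges f).card + 1 + G.ciliaCount f + n * G.ciliaCount f : ℕ) := by
  classical
  have hW := G.isCyclicSucc_nextWhite
  have hB := G.isCyclicSucc_nextBlack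
  have hpolar : ∑ y, G.faceBoundary f y * ∑ x, m x *
      ((if G.whiteKey x < G.whiteKey y then 1 else 0) +
        if G.blackKey x < G.blackKey y then 1 else 0) = ((n * G.ciliaCount f : ℕ) : ZMod 2) := by
    simp only [mul_add, Finset.sum_add_distrib]
    rw [sum_faceBoundary_mul, sum_faceBoundary_mul']
    have e1 : ∀ e : G.faceEdges f, (∑ x, m x * if G.whiteKey x < G.whiteKey e then 1 else 0) +
        (∑ x, m x * if G.whiteKey x < G.whiteKey (G.nextWhite e) then 1 else 0) =
        m e + if (G.whiteOrder (G.white e)).getLast? = some (e : E) then (n : ZMod 2) else 0 := by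
      intro e
      have := hW.sum_mul_lt m e
      rw [hw] at this
      rw [← this, ← Finset.sum_add_distrib]
      simp only [mul_add]
    have e2 : ∀ e : G.faceEdges f, (∑ x, m x * if G.blackKey x < G.blackKey e then 1 else 0) +
        (∑ x, m x * if G.blackKey x < G.blackKey (G.nextBlack e) then 1 else 0) =
        m e + if (G.blackOrder (G.black e)).getLast? = some (e : E) then (n : ZMod 2) else 0 := by
      intro e
      have := hB.sum_mul_lt m e
      rw [hb] at this
      rw [← this, ← Finset.sum_add_distrib]
      simp only [mul_add]
    have e3 : ∀ p : E → Prop, ∀ [DecidablePred p], ∑ e : G.faceEdges f,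
        (if p e then (n : ZMod 2) else 0) =
          ((n * ((G.faceEdges f).filter p).card : ℕ) : ZMod 2) := by
      intro p _
      rw [Finset.sum_coe_sort (G.faceEdges f) fun e => if p e then (n : ZMod 2) else 0,
        ← Finset.sum_filter, Finset.sum_const, nsmul_eq_mul, Nat.cast_mul, mul_comm]
    simp only [e1, e2, Finset.sum_add_distrib]
    rw [e3 fun e => (G.whiteOrder (G.white e)).getLast? = some e,
      e3 fun e => (G.blackOrder (G.black e)).getLast? = some e, ciliaCount]
    push_cast
    linear_combination (exp := 1) CharTwo.add_self_eq_zero (∑ e : G.faceEdges f, m e)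
  rw [crossing, crossingForm_add hW.injective hB.injective, hpolar]
  have := G.crossing_faceBoundary f
  rw [crossing] at this
  rw [this, crossing]
  push_cast
  ring

end CiliatedGraph

/-! ### Faces span the cycle space -/

theorem finrank_le_one_of_forall_const {ι K : Type*} [Field K] [Fintype ι]
    (W : Submodule K (ι → K)) (h : ∀ x ∈ W, ∀ i j, x i = x j) : Module.finrank K W ≤ 1 := by
  have hle : W ≤ Submodule.span K {1} := by
    intro x hx
    rw [Submodule.mem_span_singleton]
    rcases isEmpty_or_nonempty ι with hι | ⟨⟨i⟩⟩
    · exact ⟨0, Subsingleton.elim _ _⟩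
    · exact ⟨x i, funext fun j => by simp [h x hx i j]⟩
  exact (Submodule.finrank_mono hle).trans (finrank_span_le_card _ |>.trans (by simp))

namespace CiliatedGraph

variable {N : ℕ} {E : Type u}

/-- The edge `e` ends at the vertex `x`. -/
def IsEnd (G : CiliatedGraph N E) (x : Fin N ⊕ Fin N) (e : E) : Prop :=
  x = Sum.inl (G.black e) ∨ x = Sum.inr (G.white e)

theorem exists_isEnd_of_adj (G : CiliatedGraph N E) {x y : Fin N ⊕ Fin N}
    (h : G.toSimpleGraph.Adj x y) : ∃ e, G.IsEnd x e ∧ G.IsEnd y e := by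
  rw [toSimpleGraph, SimpleGraph.fromRel_adj] at h
  obtain ⟨-, ⟨e, hx, hy⟩ | ⟨e, hy, hx⟩⟩ := h
  · exact ⟨e, Or.inl hx, Or.inr hy⟩
  · exact ⟨e, Or.inr hx, Or.inl hy⟩

theorem eq_of_connected {α : Type*} (G : CiliatedGraph N E) (hG : G.toSimpleGraph.Connected)
    (x : Fin N ⊕ Fin N → α) (hx : ∀ e, x (Sum.inl (G.black e)) = x (Sum.inr (G.white e)))
    (u v : Fin N ⊕ Fin N) : x u = x v := by
  obtain ⟨p⟩ := hG.preconnected u v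
  induction p with
  | nil => rfl
  | cons h _ ih =>
    obtain ⟨e, h1 | h1, h2 | h2⟩ := G.exists_isEnd_of_adj h <;> simp only [← ih, h1, h2, hx]

theorem eq_of_connected_of_isEnd {α : Type*} (G : CiliatedGraph N E)
    (hG : G.toSimpleGraph.Connected) (g : E → α)
    (hg : ∀ x e e', G.IsEnd x e → G.IsEnd x e' → g e = g e') (e e' : E) : g e = g e' := by
  have key : ∀ u v, ∀ p : G.toSimpleGraph.Walk u v, ∀ e e', G.IsEnd u e → G.IsEnd v e' →
      g e = g e' := by
    intro u v p
    induction p with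
    | nil => intro e e' h h'; exact hg _ _ _ h h'
    | cons h _ ih =>
      intro e e' h1 h2
      obtain ⟨e0, h3, h4⟩ := G.exists_isEnd_of_adj h
      exact (hg _ _ _ h1 h3).trans (ih _ _ h4 h2)
  obtain ⟨p⟩ := hG.preconnected (Sum.inl (G.black e)) (Sum.inl (G.black e'))
  exact key _ _ p e e' (Or.inl rfl) (Or.inl rfl)

/-- The incidence matrix between vertices and edges. -/
def incidence (G : CiliatedGraph N E) : Matrix (Fin N ⊕ Fin N) E (ZMod 2)
  | Sum.inl b, e => if G.black e = b then 1 else 0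
  | Sum.inr w, e => if G.white e = w then 1 else 0

theorem mem_ker_incidence [Fintype E] (G : CiliatedGraph N E) (c : E → ZMod 2) :
    c ∈ LinearMap.ker G.incidence.mulVecLin ↔
      (∀ b, ∑ e ∈ Finset.univ.filter (fun e => G.black e = b), c e = 0) ∧
        ∀ w, ∑ e ∈ Finset.univ.filter (fun e => G.white e = w), c e = 0 := by
  rw [LinearMap.mem_ker, funext_iff, Sum.forall]
  simp [Matrix.mulVec, dotProduct, incidence, Finset.sum_filter]

/-- Modulo 2, a vector in the kernel of the transpose has equal values at the two ends of every
edge, so by connectedness it is constant. -/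
theorem le_rank_incidence [Fintype E] (G : CiliatedGraph N E)
    (hG : G.toSimpleGraph.Connected) :
    2 * N ≤ G.incidence.rank + 1 := by
  have h1 := LinearMap.finrank_range_add_finrank_ker G.incidence.transpose.mulVecLin
  have h2 : Module.finrank (ZMod 2) (LinearMap.ker G.incidence.transpose.mulVecLin) ≤ 1 := by
    refine finrank_le_one_of_forall_const _ fun x hx => ?_
    rw [LinearMap.mem_ker] at hx
    refine G.eq_of_connected hG x fun e => ?_
    have h := congrFun hx e
    simp [Matrix.vecMul, dotProduct, incidence] at h
    exact CharTwo.add_eq_zero.1 h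
  rw [← Matrix.rank_transpose, Matrix.rank]
  simp only [Module.finrank_fintype_fun_eq_card, Fintype.card_sum, Fintype.card_fin] at h1
  omega

variable [DecidableEq E]

theorem eq_of_forall_formPerm {α : Type*} (l : List E) (hl : l.Nodup) (g : E → α)
    (hg : ∀ e ∈ l, g (l.formPerm e) = g e) (e e' : E) (he : e ∈ l) (he' : e' ∈ l) :
    g e = g e' := by
  obtain ⟨i, rfl⟩ := hl.isCycleOn_formPerm.2 he he'
  have hmem : ∀ x, l.formPerm x ∈ l ↔ x ∈ l := fun x => List.formPerm_mem_iff_mem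
  have key : ∀ i : ℤ, (l.formPerm ^ i) e ∈ l ∧ g ((l.formPerm ^ i) e) = g e := by
    intro i
    induction i using Int.induction_on with
    | zero => simp [he]
    | succ k ih =>
      rw [add_comm, zpow_add, zpow_one, Equiv.Perm.mul_apply]
      exact ⟨(hmem _).2 ih.1, (hg _ ih.1).trans ih.2⟩
    | pred k ih =>
      have h1 : l.formPerm ((l.formPerm ^ (-(k : ℤ) - 1)) e) = (l.formPerm ^ (-(k : ℤ))) e := by
        rw [← Equiv.Perm.mul_apply, ← zpow_one_add]
        congr 2
        ring
      have h2 : (l.formPerm ^ (-(k : ℤ) - 1)) e ∈ l := by rw [← hmem, h1]; exact ih.1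
      exact ⟨h2, by rw [← hg _ h2, h1]; exact ih.2⟩
  exact (key i).2.symm

instance (G : CiliatedGraph N E) [Finite E] : Finite G.Face :=
  inferInstanceAs (Finite (Quotient _))

/-- Both sides are the face on the right of `e`, reached from its white and from its black end. -/
theorem leftFace_nextWhite_symm (G : CiliatedGraph N E) (e : E) :
    G.leftFace (G.nextWhite.symm e) = G.leftFace (G.nextBlack.symm e) := by
  rw [← G.leftFace_faceStep (G.nextWhite.symm e)]
  simp [faceStep]

/-- The sum of the boundaries of the faces, with given multiplicities. -/
def boundaryMap (G : CiliatedGraph N E) : (G.Face → ZMod 2) →ₗ[ZMod 2] (E → ZMod 2) where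
  toFun a e := a (G.leftFace e) + a (G.leftFace (G.nextWhite.symm e))
  map_add' a b := by funext e; simp only [Pi.add_apply]; ring
  map_smul' c a := by funext e; simp only [Pi.smul_apply, smul_eq_mul, RingHom.id_apply]; ring

/-- A vanishing boundary forces equal coefficients on the two sides of every edge. Turning around a
vertex then keeps the coefficient fixed, and connectedness carries it to all faces. -/
theorem finrank_ker_boundaryMap_le (G : CiliatedGraph N E) [Fintype E]
    (hG : G.toSimpleGraph.Connected) :
    Module.finrank (ZMod 2) (LinearMap.ker G.boundaryMap) ≤ 1 := by
  have := Fintype.ofFinite G.Face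
  refine finrank_le_one_of_forall_const _ fun a ha => ?_
  rw [LinearMap.mem_ker] at ha
  have hW : ∀ e, a (G.leftFace (G.nextWhite e)) = a (G.leftFace e) := by
    intro e
    have h := congrFun ha (G.nextWhite e)
    simp only [boundaryMap, LinearMap.coe_mk, AddHom.coe_mk, Equiv.symm_apply_apply] at h
    exact CharTwo.add_eq_zero.1 h
  have hB : ∀ e, a (G.leftFace (G.nextBlack e)) = a (G.leftFace e) := by
    intro e
    have h := congrFun ha (G.nextBlack e)
    simp only [boundaryMap, LinearMap.coe_mk, AddHom.coe_mk, leftFace_nextWhite_symm,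
      Equiv.symm_apply_apply] at h
    exact CharTwo.add_eq_zero.1 h
  have hconst : ∀ e e', a (G.leftFace e) = a (G.leftFace e') := by
    refine G.eq_of_connected_of_isEnd hG (fun e => a (G.leftFace e)) fun x e e' he he' => ?_
    rcases x with b | w
    · simp only [IsEnd, Sum.inl.injEq, reduceCtorEq, or_false] at he he'
      refine eq_of_forall_formPerm _ (G.nodup_blackOrder b) (fun e => a (G.leftFace e))
        (fun e he => ?_) e e' ((G.mem_blackOrder _ _).2 he.symm) ((G.mem_blackOrder _ _).2 he'.symm)
      rw [G.mem_blackOrder] at he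
      subst he
      exact hB e
    · simp only [IsEnd, Sum.inr.injEq, reduceCtorEq, false_or] at he he'
      refine eq_of_forall_formPerm _ (G.nodup_whiteOrder w) (fun e => a (G.leftFace e))
        (fun e he => ?_) e e' ((G.mem_whiteOrder _ _).2 he.symm) ((G.mem_whiteOrder _ _).2 he'.symm)
      rw [G.mem_whiteOrder] at he
      subst he
      exact hW e
  intro f f'
  obtain ⟨e, rfl⟩ := Quotient.exists_rep f
  obtain ⟨e', rfl⟩ := Quotient.exists_rep f'
  exact hconst e e'

variable [Fintype E]

/-- The boundaries are cycles, their span has dimension at least `|F| - 1`, and the cycle space has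
dimension at most `|E| - 2N + 1`; Euler's formula makes the two bounds equal. -/
theorem range_boundaryMap (G : CiliatedGraph N E) (hG : G.IsPlane) :
    LinearMap.range G.boundaryMap = LinearMap.ker G.incidence.mulVecLin := by
  have := Fintype.ofFinite G.Face
  apply Submodule.eq_of_le_of_finrank_le
  · rintro _ ⟨a, rfl⟩
    rw [mem_ker_incidence]
    constructor
    · intro b
      simp only [boundaryMap, LinearMap.coe_mk, AddHom.coe_mk, leftFace_nextWhite_symm,
        Finset.sum_filter]
      have : ∀ e, (if G.black e = b then
          a (G.leftFace e) + a (G.leftFace (G.nextBlack.symm e)) else 0) =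
          (if G.black e = b then a (G.leftFace e) else 0) +
          (if G.black (G.nextBlack.symm e) = b then
            a (G.leftFace (G.nextBlack.symm e)) else 0) := by
        intro e
        have hv := G.isCyclicSucc_nextBlack.vertex (G.nextBlack.symm e)
        rw [Equiv.apply_symm_apply] at hv
        rw [← hv]
        split_ifs <;> simp
      simp only [this, Finset.sum_add_distrib]
      rw [Equiv.sum_comp G.nextBlack.symm fun e => if G.black e = b then a (G.leftFace e) else 0,
        CharTwo.add_self_eq_zero]
    · intro w
      simp only [boundaryMap, LinearMap.coe_mk, AddHom.coe_mk, Finset.sum_filter]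
      have : ∀ e, (if G.white e = w then
          a (G.leftFace e) + a (G.leftFace (G.nextWhite.symm e)) else 0) =
          (if G.white e = w then a (G.leftFace e) else 0) +
          (if G.white (G.nextWhite.symm e) = w then
            a (G.leftFace (G.nextWhite.symm e)) else 0) := by
        intro e
        have hv := G.isCyclicSucc_nextWhite.vertex (G.nextWhite.symm e)
        rw [Equiv.apply_symm_apply] at hv
        rw [← hv]
        split_ifs <;> simp
      simp only [this, Finset.sum_add_distrib]
      rw [Equiv.sum_comp G.nextWhite.symm fun e => if G.white e = w then a (G.leftFace e) else 0,
        CharTwo.add_self_eq_zero]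
  · have h1 := LinearMap.finrank_range_add_finrank_ker G.boundaryMap
    have h2 := LinearMap.finrank_range_add_finrank_ker G.incidence.mulVecLin
    have h3 := G.le_rank_incidence hG.connected
    have h4 := G.finrank_ker_boundaryMap_le hG.connected
    have h5 := hG.euler
    rw [Nat.card_eq_fintype_card] at h5
    rw [Matrix.rank] at h3
    simp only [Module.finrank_fintype_fun_eq_card] at h1 h2
    omega

theorem boundaryMap_eq_sum (G : CiliatedGraph N E) [Fintype G.Face] (a : G.Face → ZMod 2) :
    G.boundaryMap a = ∑ f, a f • G.faceBoundary f := by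
  classical
  funext e
  have h : ∀ f, G.faceBoundary f e = (if G.leftFace e = f then 1 else 0) +
      if G.leftFace (G.nextWhite.symm e) = f then 1 else 0 := by
    intro f
    have h1 : ∀ j : E → E, ∀ e', (∀ x, j x = e ↔ x = e') →
        fiberCount (j ∘ ((↑) : G.faceEdges f → E)) e = if G.leftFace e' = f then 1 else 0 := by
      intro j e' hj
      unfold fiberCount
      simp only [Function.comp_apply, hj]
      rw [Finset.sum_coe_sort (G.faceEdges f) fun x => if x = e' then (1 : ZMod 2) else 0]
      simp [mem_faceEdges]
    rw [faceBoundary, Pi.add_apply]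
    congr 1
    · exact h1 id e fun x => Iff.rfl
    · exact h1 G.nextWhite _ fun x => (Equiv.eq_symm_apply _).symm
  simp only [Finset.sum_apply, Pi.smul_apply, smul_eq_mul, h, mul_add, Finset.sum_add_distrib]
  simp [boundaryMap]

theorem exists_eq_sum_faceBoundary (G : CiliatedGraph N E) (hG : G.IsPlane) (outer : G.Face)
    [Fintype G.Face] (c : E → ZMod 2)
    (hb : ∀ b, ∑ e ∈ Finset.univ.filter (fun e => G.black e = b), c e = 0)
    (hw : ∀ w, ∑ e ∈ Finset.univ.filter (fun e => G.white e = w), c e = 0) :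
    ∃ a : G.Face → ZMod 2, a outer = 0 ∧ c = ∑ f, a f • G.faceBoundary f := by
  have hc : c ∈ LinearMap.range G.boundaryMap := by
    rw [range_boundaryMap G hG, mem_ker_incidence]
    exact ⟨hb, hw⟩
  obtain ⟨a, rfl⟩ := hc
  -- Adding a constant to all coefficients does not change the boundary, because every edge has two
  -- sides.
  refine ⟨fun f => a f + a outer, CharTwo.add_self_eq_zero _, ?_⟩
  rw [← boundaryMap_eq_sum]
  funext e
  simp only [boundaryMap, LinearMap.coe_mk, AddHom.coe_mk]
  linear_combination (exp := 1) -CharTwo.add_self_eq_zero (a outer)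

/-! ### The Kasteleyn sign of a multiweb -/

/-- For either parity of `n` the Kasteleyn exponent is `l/2 + 1 + (1 + n) * k` modulo 2, the same as
the jump of the crossing form. -/
theorem crossing_add_linear_faceBoundary (G : CiliatedGraph N E) {n : ℕ} {outer : G.Face}
    {x : E → ZMod 2} (hx : G.IsKasteleyn n outer fun e => (-1) ^ x e) {f : G.Face} (hf : f ≠ outer)
    (m : E → ZMod 2) (hb : ∀ b, ∑ e ∈ Finset.univ.filter (fun e => G.black e = b), m e = n)
    (hw : ∀ w, ∑ e ∈ Finset.univ.filter (fun e => G.white e = w), m e = n) :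
    G.crossing (m + G.faceBoundary f) + ∑ e, (m + G.faceBoundary f) e * x e =
      G.crossing m + ∑ e, m e * x e := by
  have h1 : ∑ e, G.faceBoundary f e * x e =
      (((G.faceEdges f).card + 1 + G.ciliaCount f + n * G.ciliaCount f : ℕ) : ZMod 2) := by
    rw [sum_faceBoundary_mul, Finset.sum_coe_sort (G.faceEdges f) fun e => x e + x (G.nextWhite e)]
    apply neg_one_uzpow_injective
    have h := hx f hf
    simp only [← uzpow_add] at h
    simp only [uzpow_sum, h]
    split_ifs with hn
    · obtain ⟨k, rfl⟩ := hn
      rw [← uzpow_intCast (R := ZMod 2)]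
      congr 1
      push_cast
      linear_combination (exp := 1) -CharTwo.add_self_eq_zero (1 : ZMod 2) -
        (1 + k) * CharTwo.add_self_eq_zero (G.ciliaCount f : ZMod 2)
    · obtain ⟨k, rfl⟩ := Nat.not_odd_iff_even.1 hn
      rw [← uzpow_intCast (R := ZMod 2)]
      congr 1
      push_cast
      linear_combination (exp := 1) -CharTwo.add_self_eq_zero (1 : ZMod 2) -
        (1 + k) * CharTwo.add_self_eq_zero (G.ciliaCount f : ZMod 2)
  simp only [Pi.add_apply, add_mul, Finset.sum_add_distrib]
  rw [h1, G.crossing_add_faceBoundary f n m hb hw]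
  linear_combination (exp := 1) CharTwo.add_self_eq_zero
    (((G.faceEdges f).card + 1 + G.ciliaCount f + n * G.ciliaCount f : ℕ) : ZMod 2)

theorem faceBoundary_vertex_sum (G : CiliatedGraph N E) (f : G.Face) :
    (∀ b, ∑ e ∈ Finset.univ.filter (fun e => G.black e = b), G.faceBoundary f e = 0) ∧
      ∀ w, ∑ e ∈ Finset.univ.filter (fun e => G.white e = w), G.faceBoundary f e = 0 := by
  constructor
  · intro b
    rw [Finset.sum_filter]
    have h := G.sum_faceBoundary_mul' f fun e => if G.black e = b then 1 else 0
    simp only [mul_ite, mul_one, mul_zero, G.isCyclicSucc_nextBlack.vertex] at h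
    rw [h]
    exact Finset.sum_eq_zero fun _ _ => CharTwo.add_self_eq_zero _
  · intro w
    rw [Finset.sum_filter]
    have h := G.sum_faceBoundary_mul f fun e => if G.white e = w then 1 else 0
    simp only [mul_ite, mul_one, mul_zero, G.isCyclicSucc_nextWhite.vertex] at h
    rw [h]
    exact Finset.sum_eq_zero fun _ _ => CharTwo.add_self_eq_zero _

theorem crossing_add_linear_eq (G : CiliatedGraph N E) (hG : G.IsPlane) {n : ℕ} {outer : G.Face}
    {x : E → ZMod 2} (hx : G.IsKasteleyn n outer fun e => (-1) ^ x e) (m m' : E → ZMod 2)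
    (hb : ∀ b, ∑ e ∈ Finset.univ.filter (fun e => G.black e = b), m e = n)
    (hw : ∀ w, ∑ e ∈ Finset.univ.filter (fun e => G.white e = w), m e = n)
    (hb' : ∀ b, ∑ e ∈ Finset.univ.filter (fun e => G.black e = b), m' e = n)
    (hw' : ∀ w, ∑ e ∈ Finset.univ.filter (fun e => G.white e = w), m' e = n) :
    G.crossing m' + ∑ e, m' e * x e = G.crossing m + ∑ e, m e * x e := by
  classical
  have := Fintype.ofFinite G.Face
  obtain ⟨a, ha, hc⟩ := G.exists_eq_sum_faceBoundary hG outer (m' - m)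
    (fun b => by simp only [Pi.sub_apply, Finset.sum_sub_distrib, hb, hb', sub_self])
    (fun w => by simp only [Pi.sub_apply, Finset.sum_sub_distrib, hw, hw', sub_self])
  rw [sub_eq_iff_eq_add'] at hc
  subst hc
  clear hb' hw'
  -- The faces are added one at a time; the vertex sums are carried along because the jump of the
  -- crossing form depends on them.
  suffices H : ∀ S : Finset G.Face,
      (∀ b, ∑ e ∈ Finset.univ.filter (fun e => G.black e = b),
        (m + ∑ f ∈ S, a f • G.faceBoundary f) e = n) ∧
      (∀ w, ∑ e ∈ Finset.univ.filter (fun e => G.white e = w),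
        (m + ∑ f ∈ S, a f • G.faceBoundary f) e = n) ∧
      G.crossing (m + ∑ f ∈ S, a f • G.faceBoundary f) +
        ∑ e, (m + ∑ f ∈ S, a f • G.faceBoundary f) e * x e = G.crossing m + ∑ e, m e * x e from
    (H Finset.univ).2.2
  intro S
  induction S using Finset.induction_on with
  | empty => simp [hb, hw]
  | insert f S hf ih =>
    rw [Finset.sum_insert hf, add_comm (a f • _), ← add_assoc]
    set m1 := m + ∑ f ∈ S, a f • G.faceBoundary f
    rcases (by revert ha; generalize a f = y; intro _; revert y; decide :
      a f = 0 ∨ a f = 1) with h0 | h0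
    · simpa [h0] using ih
    · have hne : f ≠ outer := by rintro rfl; rw [h0] at ha; exact one_ne_zero ha
      rw [h0, one_smul]
      have hv := G.faceBoundary_vertex_sum f
      refine ⟨fun b => ?_, fun w => ?_, ?_⟩
      · simp only [Pi.add_apply m1, Finset.sum_add_distrib, ih.1, hv.1, add_zero]
      · simp only [Pi.add_apply m1, Finset.sum_add_distrib, ih.2.1, hv.2, add_zero]
      · rw [G.crossing_add_linear_faceBoundary hx hne m1 ih.1 ih.2.1]
        exact ih.2.2

theorem exists_sign_crossing (G : CiliatedGraph N E) (hG : G.IsPlane) {n : ℕ} {outer : G.Face}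
    {ε : E → ℤˣ} (hε : G.IsKasteleyn n outer ε) :
    ∃ s : ℤˣ, ∀ m : E → ℕ,
      (∀ b, ∑ e ∈ Finset.univ.filter (fun e => G.black e = b), m e = n) →
      (∀ w, ∑ e ∈ Finset.univ.filter (fun e => G.white e = w), m e = n) →
      (-1) ^ G.crossing (fun e => (m e : ZMod 2)) = s * ∏ e, ε e ^ m e := by
  choose x hx using fun e => exists_neg_one_uzpow (ε e)
  have hK : G.IsKasteleyn n outer fun e => (-1) ^ x e := by simpa only [hx] using hε
  have hprod : ∀ m : E → ℕ, ∏ e, ε e ^ m e = (-1) ^ (∑ e, (m e : ZMod 2) * x e) := by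
    intro m
    rw [uzpow_sum]
    refine Finset.prod_congr rfl fun e _ => ?_
    rw [mul_comm, uzpow_mul, hx, uzpow_natCast]
  by_cases h : ∃ m : E → ℕ, (∀ b, ∑ e ∈ Finset.univ.filter (fun e => G.black e = b), m e = n) ∧
      ∀ w, ∑ e ∈ Finset.univ.filter (fun e => G.white e = w), m e = n
  · obtain ⟨m, hb, hw⟩ := h
    refine ⟨(-1) ^ (G.crossing (fun e => (m e : ZMod 2)) + ∑ e, (m e : ZMod 2) * x e),
      fun m' hb' hw' => ?_⟩
    rw [hprod, ← G.crossing_add_linear_eq hG hK (fun e => (m e : ZMod 2))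
      (fun e => (m' e : ZMod 2)) (fun b => by rw [← Nat.cast_sum, hb])
      (fun w => by rw [← Nat.cast_sum, hw]) (fun b => by rw [← Nat.cast_sum, hb'])
      (fun w => by rw [← Nat.cast_sum, hw']), ← uzpow_add, add_assoc,
      CharTwo.add_self_eq_zero, add_zero]
  -- Without multiwebs any sign will do.
  · exact ⟨1, fun m hb hw => absurd ⟨m, hb, hw⟩ h⟩

end CiliatedGraph

/-! ### Inversions of words -/

section Inversions

variable {n : ℕ}

theorem inversionCount_append_swap (u v : List (Fin n)) {a b : Fin n} (hab : a < b) :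
    inversionCount (u ++ b :: a :: v) = inversionCount (u ++ a :: b :: v) + 1 := by
  induction u with
  | nil =>
    simp [inversionCount, hab, hab.not_gt]
    omega
  | cons c u ih =>
    have hp : (u ++ b :: a :: v).Perm (u ++ a :: b :: v) :=
      (List.Perm.swap a b v).append_left u
    simp only [List.cons_append, inversionCount, ih, hp.countP_eq]
    omega

theorem codet_append_swap (q : ℂ) (u v : List (Fin n)) {a b : Fin n} (hab : a < b) :
    codet q (u ++ b :: a :: v) = -q * codet q (u ++ a :: b :: v) := by
  have hp : (u ++ b :: a :: v).Perm (u ++ a :: b :: v) := (List.Perm.swap a b v).append_left u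
  unfold codet
  simp only [hp.nodup_iff, hp.length_eq, inversionCount_append_swap u v hab]
  split_ifs
  · rw [pow_succ']
  · simp

theorem codet_eq_zero (q : ℂ) {l : List (Fin n)} (h : ¬ l.Nodup) : codet q l = 0 :=
  if_neg fun H => h H.1

theorem inversionCount_eq_zero_of_pairwise {l : List (Fin n)} (h : l.Pairwise (· ≤ ·)) :
    inversionCount l = 0 := by
  induction l with
  | nil => rfl
  | cons a l ih =>
    rw [List.pairwise_cons] at h
    rw [inversionCount, ih h.2, add_zero, List.countP_eq_zero]
    intro b hb
    simpa using h.1 b hb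

theorem map_swap_comp {X Y : Type*} [DecidableEq X] (f : X → Y) {u v : List X} {x y : X}
    (h : (u ++ x :: y :: v).Nodup) :
    (u ++ x :: y :: v).map (f ∘ Equiv.swap x y) = u.map f ++ f y :: f x :: v.map f := by
  have h' := h.perm (List.perm_middle.trans (List.perm_middle.cons x))
  simp only [List.nodup_cons, List.mem_cons, List.mem_append, not_or] at h'
  obtain ⟨⟨hxy, hxu, hxv⟩, ⟨hyu, hyv⟩, -⟩ := h'
  have key : ∀ l : List X, x ∉ l → y ∉ l → l.map (f ∘ Equiv.swap x y) = l.map f := by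
    intro l h1 h2
    refine List.map_congr_left fun z hz => ?_
    rw [Function.comp_apply, Equiv.swap_apply_of_ne_of_ne]
    · rintro rfl; exact h1 hz
    · rintro rfl; exact h2 hz
  simp [key u hxu hyu, key v hxv hyv]

theorem exists_eq_append_of_succ {m k : ℕ} (hk : k + 1 < m) :
    ∃ u v : List (Fin m), List.finRange m = u ++ ⟨k, by omega⟩ :: ⟨k + 1, hk⟩ :: v := by
  refine ⟨(List.finRange m).take k, (List.finRange m).drop (k + 2), ?_⟩
  conv_lhs => rw [← List.take_append_drop k (List.finRange m)]
  rw [List.drop_eq_getElem_cons (by simp; omega), List.drop_eq_getElem_cons (by simp; omega)]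
  simp

theorem inversionCount_ofFn_swap {m k : ℕ} (hk : k + 1 < m) (f : Fin m → Fin n)
    (h : f ⟨k, by omega⟩ < f ⟨k + 1, hk⟩) :
    inversionCount (List.ofFn (f ∘ Equiv.swap (⟨k, by omega⟩ : Fin m) ⟨k + 1, hk⟩)) =
      inversionCount (List.ofFn f) + 1 := by
  obtain ⟨u, v, huv⟩ := exists_eq_append_of_succ hk
  have hn := List.nodup_finRange m
  rw [List.ofFn_eq_map, List.ofFn_eq_map, huv, map_swap_comp f (huv ▸ hn),
    inversionCount_append_swap _ _ h]
  simp

theorem exists_descent {α : Type*} [LinearOrder α] {m : ℕ} {f : Fin m → α} (h : ¬ Monotone f) :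
    ∃ (k : ℕ) (hk : k + 1 < m), f ⟨k + 1, hk⟩ < f ⟨k, by omega⟩ := by
  by_contra! H
  apply h
  cases m with
  | zero => exact fun i => i.elim0
  | succ m =>
    rw [Fin.monotone_iff_le_succ]
    exact fun i => H i (by omega)

/-- The inversion generating function of the words without repetition on a given alphabet. -/
theorem sum_pow_inversionCount (t : ℂ) (m : ℕ) (S : Finset (Fin n)) (hS : S.card = m) :
    ∑ f : Fin m → Fin n, (if Function.Injective f ∧ Finset.univ.image f = S then
      t ^ inversionCount (List.ofFn f) else 0) =
      ∏ i ∈ Finset.range m, ∑ j ∈ Finset.range (i + 1), t ^ j := by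
  induction m generalizing S with
  | zero =>
    rw [Finset.card_eq_zero] at hS
    subst hS
    simp [Function.injective_of_subsingleton, inversionCount]
  | succ m ih =>
    -- A first letter `a` creates one inversion for each smaller letter of the alphabet, and these
    -- ranks run through `0, …, T.card - 1`.
    have hrank : ∀ T : Finset (Fin n), ∑ a ∈ T, t ^ (T.filter (· < a)).card =
        ∑ j ∈ Finset.range T.card, t ^ j := by
      intro T
      induction T using Finset.induction_on_max with
      | empty => simp
      | insert a T hT ihT =>
        have ha : a ∉ T := fun h => lt_irrefl _ (hT a h)
        rw [Finset.sum_insert ha, Finset.card_insert_of_notMem ha, Finset.sum_range_succ, ← ihT,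
          add_comm]
        congr 1
        · refine Finset.sum_congr rfl fun b hb => ?_
          rw [Finset.filter_insert, if_neg (hT b hb).not_gt]
        · rw [Finset.filter_insert, if_neg (lt_irrefl a), Finset.filter_true_of_mem hT]
    rw [← (Fin.consEquiv fun _ : Fin (m + 1) => Fin n).sum_comp, Fintype.sum_prod_type]
    have hterm : ∀ a : Fin n, ∀ g : Fin m → Fin n,
        (if Function.Injective (Fin.consEquiv (fun _ : Fin (m + 1) => Fin n) (a, g)) ∧
          Finset.univ.image (Fin.consEquiv (fun _ : Fin (m + 1) => Fin n) (a, g)) = S then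
          t ^ inversionCount (List.ofFn (Fin.consEquiv (fun _ : Fin (m + 1) => Fin n) (a, g)))
          else 0) =
        if a ∈ S then t ^ (S.filter (· < a)).card *
          (if Function.Injective g ∧ Finset.univ.image g = S.erase a then
            t ^ inversionCount (List.ofFn g) else 0) else 0 := by
      intro a g
      have himg : Finset.univ.image (Fin.cons a g : Fin (m + 1) → Fin n) =
          insert a (Finset.univ.image g) := by
        ext b
        simp [Fin.exists_fin_succ, eq_comm]
      have hiff : (Function.Injective (Fin.cons a g : Fin (m + 1) → Fin n) ∧
          Finset.univ.image (Fin.cons a g : Fin (m + 1) → Fin n) = S) ↔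
          a ∈ S ∧ Function.Injective g ∧ Finset.univ.image g = S.erase a := by
        rw [Fin.cons_injective_iff, himg]
        constructor
        · rintro ⟨⟨h1, h2⟩, rfl⟩
          refine ⟨Finset.mem_insert_self _ _, h2, ?_⟩
          rw [Finset.erase_insert]
          simpa using h1
        · rintro ⟨h1, h2, h3⟩
          refine ⟨⟨?_, h2⟩, by rw [h3, Finset.insert_erase h1]⟩
          rintro ⟨i, hi⟩
          have : a ∈ Finset.univ.image g := Finset.mem_image.2 ⟨i, Finset.mem_univ _, hi⟩
          rw [h3] at this
          exact Finset.notMem_erase _ _ this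
      change (if Function.Injective (Fin.cons a g : Fin (m + 1) → Fin n) ∧
        Finset.univ.image (Fin.cons a g : Fin (m + 1) → Fin n) = S then
        t ^ inversionCount (List.ofFn (Fin.cons a g : Fin (m + 1) → Fin n)) else 0) = _
      simp only [hiff]
      by_cases h1 : a ∈ S
      · by_cases h2 : Function.Injective g ∧ Finset.univ.image g = S.erase a
        · simp only [h1, h2, and_self, if_true]
          rw [List.ofFn_cons, inversionCount, pow_add]
          congr 2
          rw [List.countP_eq_length_filter, ← List.toFinset_card_of_nodup
            ((List.nodup_ofFn.2 h2.1).filter _), List.toFinset_filter]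
          congr 1
          have h3 : (List.ofFn g).toFinset = Finset.univ.image g := by
            ext b; simp [List.mem_ofFn]
          rw [h3, h2.2]
          ext b
          simp only [Finset.mem_filter, Finset.mem_erase, decide_eq_true_eq]
          exact ⟨fun h => ⟨h.1.2, h.2⟩, fun h => ⟨⟨h.2.ne, h.1⟩, h.2⟩⟩
        · simp [h2]
      · simp [h1]
    simp only [hterm]
    have hsum : ∀ a : Fin n, (∑ g : Fin m → Fin n,
        if a ∈ S then t ^ (S.filter (· < a)).card *
          (if Function.Injective g ∧ Finset.univ.image g = S.erase a then
            t ^ inversionCount (List.ofFn g) else 0) else 0) =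
        if a ∈ S then t ^ (S.filter (· < a)).card *
          ∏ i ∈ Finset.range m, ∑ j ∈ Finset.range (i + 1), t ^ j else 0 := by
      intro a
      by_cases h1 : a ∈ S
      · simp only [h1, if_true]
        rw [← Finset.mul_sum, ih _ (by rw [Finset.card_erase_of_mem h1, hS]; rfl)]
      · simp [h1]
    simp only [hsum]
    rw [Finset.sum_ite_mem, Finset.univ_inter, ← Finset.sum_mul, hrank, hS, mul_comm,
      Finset.prod_range_succ]

/-- Identifies the fiber of sorting over `g` with the words counted by `sum_pow_inversionCount`. -/
theorem comp_sort_eq_iff {m : ℕ} {f g : Fin m → Fin n} (hg : StrictMono g) :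
    f ∘ Tuple.sort f = g ↔
      Function.Injective f ∧ Finset.univ.image f = Finset.univ.image g := by
  constructor
  · intro h
    refine ⟨?_, ?_⟩
    · have := hg.injective
      rw [← h] at this
      exact (Function.Injective.of_comp_iff' f (Tuple.sort f).bijective).1 this
    · rw [← h]
      ext b
      simp only [Finset.mem_image, Finset.mem_univ, true_and, Function.comp_apply]
      exact (Tuple.sort f).surjective.exists (p := fun i => f i = b)
  · rintro ⟨h1, h2⟩
    have h3 : StrictMono (f ∘ Tuple.sort f) :=
      (Tuple.monotone_sort f).strictMono_of_injective (h1.comp (Tuple.sort f).injective)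
    have hr : Set.range (f ∘ Tuple.sort f) = Set.range g := by
      rw [(Tuple.sort f).surjective.range_comp]
      have := congrArg (fun s : Finset (Fin n) => (s : Set (Fin n))) h2
      simpa using this
    exact (StrictMono.range_inj h3 hg).1 hr

theorem pow_mul_qInt_succ {q : ℂ} (hq : q ≠ 0) (m : ℕ) :
    q ^ m * qInt q (m + 1) = ∑ j ∈ Finset.range (m + 1), (q ^ 2) ^ j := by
  rw [qInt, Finset.mul_sum, ← Finset.sum_range_reflect]
  refine Finset.sum_congr rfl fun j hj => ?_
  rw [Finset.mem_range] at hj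
  rw [← pow_mul, ← zpow_natCast, ← zpow_natCast, ← zpow_add₀ hq]
  congr 1
  omega

theorem prod_sum_pow_eq_qFactorial {q : ℂ} (hq : q ≠ 0) (m : ℕ) :
    ∏ i ∈ Finset.range m, ∑ j ∈ Finset.range (i + 1), (q ^ 2) ^ j =
      q ^ m.choose 2 * qFactorial q m := by
  induction m with
  | zero => simp [qFactorial]
  | succ m ih =>
    rw [Finset.prod_range_succ, ih, ← pow_mul_qInt_succ hq, qFactorial, qFactorial,
      Finset.prod_range_succ, Nat.choose_succ_succ' m 1, Nat.choose_one_right, pow_add]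
    ring

theorem sum_sort_eq_pow_inversionCount {q : ℂ} (hq : q ≠ 0) {m : ℕ} {g : Fin m → Fin n}
    (hg : StrictMono g) :
    ∑ f ∈ Finset.univ.filter (fun f : Fin m → Fin n => f ∘ Tuple.sort f = g),
      (q ^ 2) ^ inversionCount (List.ofFn f) = q ^ m.choose 2 * qFactorial q m := by
  rw [Finset.sum_filter, ← prod_sum_pow_eq_qFactorial hq]
  simp only [comp_sort_eq_iff hg]
  exact sum_pow_inversionCount _ _ _ (by
    rw [Finset.card_image_of_injective _ hg.injective, Finset.card_univ, Fintype.card_fin])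

/-- If `[i + 1]` vanishes, the geometric sum gives `q ^ (2 * (i + 1)) = 1`, hence `q = ±1` for `i ≥
1`; but then that sum equals `i + 1`. -/
theorem qFactorial_ne_zero {q : ℂ} (hq : QAdmissible n q) {m : ℕ} (hm : m ≤ n) :
    qFactorial q m ≠ 0 := by
  obtain ⟨hq0, hq⟩ := hq
  refine Finset.prod_ne_zero_iff.2 fun i hi => ?_
  rw [Finset.mem_range] at hi
  have h1 := pow_mul_qInt_succ hq0 i
  intro h0
  rw [h0, mul_zero] at h1
  have h2 : (q ^ 2) ^ (i + 1) = 1 := by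
    have := mul_geom_sum (q ^ 2) (i + 1)
    rw [← h1, mul_zero] at this
    exact (sub_eq_zero.1 this.symm)
  by_cases hi0 : i = 0
  · subst hi0; simp at h1
  · have h3 : q ^ 2 = 1 := by
      rcases hq (i + 1) (by omega) (by omega) (by rw [pow_mul]; exact h2) with h | h <;>
        simp [h]
    rw [h3] at h1
    simp at h1
    norm_cast at h1

end Inversions

/-! ### Colorings of the copies of the edges -/

section SplitColoring

variable {E : Type u} {n : ℕ} {m : E → ℕ}

/-- The number of inversions of a coloring of the half-edges within the copies of single edges. -/
def splitInv [Fintype E] (ω : (Σ e, Fin (m e)) → Fin n) : ℕ :=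
  ∑ e, inversionCount (List.ofFn fun k => ω ⟨e, k⟩)

/-- Sort the colors on the copies of every edge. -/
def splitSort (ω : (Σ e, Fin (m e)) → Fin n) (x : Σ e, Fin (m e)) : Fin n :=
  ω ⟨x.1, Tuple.sort (fun k => ω ⟨x.1, k⟩) x.2⟩

theorem splitSort_eq (ω : (Σ e, Fin (m e)) → Fin n) (e : E) :
    (fun k => splitSort ω ⟨e, k⟩) = (fun k => ω ⟨e, k⟩) ∘ Tuple.sort (fun k => ω ⟨e, k⟩) := rfl

variable [DecidableEq E]

theorem comp_swap_same (ω : (Σ e, Fin (m e)) → Fin n) (e : E) (a b : Fin (m e)) :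
    (fun k => (ω ∘ Equiv.swap ⟨e, a⟩ ⟨e, b⟩) ⟨e, k⟩) = (fun k => ω ⟨e, k⟩) ∘ Equiv.swap a b := by
  funext k
  have h : Function.Injective (Sigma.mk (β := fun e => Fin (m e)) e) := sigma_mk_injective
  simp only [Function.comp_apply]
  rw [← h.map_swap]

theorem comp_swap_of_ne (ω : (Σ e, Fin (m e)) → Fin n) (e : E) (a b : Fin (m e)) {e' : E}
    (h : e' ≠ e) (k : Fin (m e')) :
    (ω ∘ Equiv.swap ⟨e, a⟩ ⟨e, b⟩) ⟨e', k⟩ = ω ⟨e', k⟩ := by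
  rw [Function.comp_apply, Equiv.swap_apply_of_ne_of_ne] <;>
    exact fun H => h (congrArg Sigma.fst H)

theorem splitSort_comp_swap (ω : (Σ e, Fin (m e)) → Fin n) (e : E) (a b : Fin (m e)) :
    splitSort (ω ∘ Equiv.swap ⟨e, a⟩ ⟨e, b⟩) = splitSort ω := by
  funext ⟨e', k⟩
  refine congrFun (?_ : (fun k => splitSort (ω ∘ Equiv.swap ⟨e, a⟩ ⟨e, b⟩) ⟨e', k⟩) =
    fun k => splitSort ω ⟨e', k⟩) k
  rw [splitSort_eq, splitSort_eq]
  by_cases h : e' = e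
  · subst h
    rw [comp_swap_same, Tuple.comp_perm_comp_sort_eq_comp_sort]
  · simp only [comp_swap_of_ne ω e a b h]

variable [Fintype E]

theorem splitInv_comp_swap (ω : (Σ e, Fin (m e)) → Fin n) (e : E) {k : ℕ} (hk : k + 1 < m e)
    (h : ω ⟨e, ⟨k, by omega⟩⟩ < ω ⟨e, ⟨k + 1, hk⟩⟩) :
    splitInv (ω ∘ Equiv.swap ⟨e, ⟨k, by omega⟩⟩ ⟨e, ⟨k + 1, hk⟩⟩) = splitInv ω + 1 := by
  unfold splitInv
  rw [← Finset.add_sum_erase _ _ (Finset.mem_univ e),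
    ← Finset.add_sum_erase Finset.univ
      (fun e => inversionCount (List.ofFn fun k => ω ⟨e, k⟩)) (Finset.mem_univ e),
    comp_swap_same, inversionCount_ofFn_swap hk _ h]
  have : ∀ e' ∈ Finset.univ.erase e, inversionCount (List.ofFn fun k' =>
      (ω ∘ Equiv.swap ⟨e, ⟨k, by omega⟩⟩ ⟨e, ⟨k + 1, hk⟩⟩) ⟨e', k'⟩) =
      inversionCount (List.ofFn fun k' => ω ⟨e', k'⟩) := by
    intro e' he'
    simp only [comp_swap_of_ne ω e _ _ (Finset.ne_of_mem_erase he')]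
  rw [Finset.sum_congr rfl this]
  omega

/-- A function of the colorings which is multiplied by `t` when an increasing pair on consecutive
copies of an edge is swapped is determined by its values at the sorted colorings. -/
theorem eq_pow_splitInv_smul {V : Type*} [AddCommGroup V] [Module ℂ V] (t : ℂ)
    (F : ((Σ e, Fin (m e)) → Fin n) → V)
    (hF : ∀ (e : E) (k : ℕ) (hk : k + 1 < m e) (ω : (Σ e, Fin (m e)) → Fin n),
      ω ⟨e, ⟨k, by omega⟩⟩ < ω ⟨e, ⟨k + 1, hk⟩⟩ →
      F (ω ∘ Equiv.swap ⟨e, ⟨k, by omega⟩⟩ ⟨e, ⟨k + 1, hk⟩⟩) = t • F ω)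
    (ω : (Σ e, Fin (m e)) → Fin n) : F ω = t ^ splitInv ω • F (splitSort ω) := by
  induction hι : splitInv ω generalizing ω with
  | zero =>
    have hmono : ∀ e, Monotone fun k => ω ⟨e, k⟩ := by
      intro e
      by_contra hm
      obtain ⟨k, hk, hlt⟩ := exists_descent hm
      -- A descent would exhibit `ω` as the swap of an increasing pair, which has at least one
      -- inversion.
      have h1 := splitInv_comp_swap (ω ∘ Equiv.swap ⟨e, ⟨k, Nat.lt_of_succ_lt hk⟩⟩ ⟨e, ⟨k + 1, hk⟩⟩)
        e hk (by simpa using hlt)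
      have h2 : (ω ∘ Equiv.swap ⟨e, ⟨k, Nat.lt_of_succ_lt hk⟩⟩ ⟨e, ⟨k + 1, hk⟩⟩) ∘
          Equiv.swap ⟨e, ⟨k, Nat.lt_of_succ_lt hk⟩⟩ ⟨e, ⟨k + 1, hk⟩⟩ = ω := by
        funext x; simp
      rw [h2, hι] at h1
      omega
    have hs : splitSort ω = ω := by
      funext ⟨e, k⟩
      have := Tuple.sort_eq_refl_iff_monotone.2 (hmono e)
      simp only [splitSort, this]
      rfl
    rw [hs, pow_zero, one_smul]
  | succ d ih =>
    have hmono : ∃ e, ¬ Monotone fun k => ω ⟨e, k⟩ := by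
      by_contra! hm
      have : splitInv ω = 0 := by
        refine Finset.sum_eq_zero fun e _ => inversionCount_eq_zero_of_pairwise ?_
        rw [List.pairwise_ofFn]
        exact fun i j hij => hm e hij.le
      omega
    obtain ⟨e, hm⟩ := hmono
    obtain ⟨k, hk, hlt⟩ := exists_descent hm
    set ω' := ω ∘ Equiv.swap ⟨e, ⟨k, by omega⟩⟩ ⟨e, ⟨k + 1, hk⟩⟩ with hω'
    have h0 : ω' ⟨e, ⟨k, by omega⟩⟩ < ω' ⟨e, ⟨k + 1, hk⟩⟩ := by simpa [hω'] using hlt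
    have h2 : ω' ∘ Equiv.swap ⟨e, ⟨k, by omega⟩⟩ ⟨e, ⟨k + 1, hk⟩⟩ = ω := by
      funext x; simp [hω']
    have h1 := splitInv_comp_swap ω' e hk h0
    have h3 := hF e k hk ω' h0
    rw [h2] at h1 h3
    rw [h3, ih ω' (by omega), hω', splitSort_comp_swap, smul_smul, pow_succ']

/-- Colorings are grouped by their sorted form. A fiber over a strictly increasing coloring
contributes a product of inversion generating functions in `q ^ 2`; any other fiber repeats a color
on some edge and contributes 0. -/
theorem sum_eq_smul_sum_strictMono {V : Type*} [AddCommGroup V] [Module ℂ V] {q : ℂ} (hq : q ≠ 0)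
    (F : ((Σ e, Fin (m e)) → Fin n) → V)
    (hF : ∀ (e : E) (k : ℕ) (hk : k + 1 < m e) (ω : (Σ e, Fin (m e)) → Fin n),
      ω ⟨e, ⟨k, by omega⟩⟩ < ω ⟨e, ⟨k + 1, hk⟩⟩ →
      F (ω ∘ Equiv.swap ⟨e, ⟨k, by omega⟩⟩ ⟨e, ⟨k + 1, hk⟩⟩) = q ^ 2 • F ω)
    (hF0 : ∀ ω, (¬ ∀ e, Function.Injective fun k => ω ⟨e, k⟩) → F ω = 0) :
    ∑ ω, F ω = (∏ e, q ^ (m e).choose 2 * qFactorial q (m e)) •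
      ∑ ω with ∀ e, StrictMono fun k => ω ⟨e, k⟩, F ω := by
  classical
  have h1 : ∑ ω, F ω = ∑ ω, ∑ ω' with splitSort ω' = ω, (q ^ 2) ^ splitInv ω' • F ω := by
    rw [← Finset.sum_fiberwise (s := Finset.univ) (g := splitSort) (f := F)]
    refine Finset.sum_congr rfl fun ω _ => Finset.sum_congr rfl fun ω' hω' => ?_
    rw [eq_pow_splitInv_smul (q ^ 2) F hF ω', (Finset.mem_filter.1 hω').2]
  rw [h1, Finset.smul_sum, Finset.sum_filter]
  refine Finset.sum_congr rfl fun ω _ => ?_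
  split_ifs with hω
  · rw [← Finset.sum_smul]
    congr 1
    have h2 : ∏ e, q ^ (m e).choose 2 * qFactorial q (m e) =
        ∏ e, ∑ f ∈ Finset.univ.filter (fun f : Fin (m e) → Fin n =>
          f ∘ Tuple.sort f = fun k => ω ⟨e, k⟩), (q ^ 2) ^ inversionCount (List.ofFn f) :=
      Finset.prod_congr rfl fun e _ => (sum_sort_eq_pow_inversionCount hq (hω e)).symm
    rw [h2, Finset.prod_univ_sum]
    refine Finset.sum_equiv (Equiv.piCurry fun _ _ => Fin n) ?_ ?_
    · intro ω'
      simp only [Finset.mem_filter, Finset.mem_univ, true_and, Fintype.mem_piFinset]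
      constructor
      · rintro rfl e
        rfl
      · intro h
        funext ⟨e, k⟩
        exact congrFun (h e) k
    · intro ω' _
      rw [splitInv, Finset.prod_pow_eq_pow_sum]
      rfl
  · obtain ⟨e, he⟩ := not_forall.1 hω
    refine Finset.sum_eq_zero fun ω' hω' => ?_
    rw [hF0, smul_zero]
    intro hinj
    apply he
    have hs := (Finset.mem_filter.1 hω').2
    refine Monotone.strictMono_of_injective ?_ (hinj e)
    rw [← hs]
    exact Tuple.monotone_sort fun k => ω' ⟨e, k⟩

end SplitColoring

/-! ### Weights of colorings -/

section Weights

variable {E : Type u} {n N : ℕ} {m : E → ℕ}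

theorem splitList_append (l l' : List E) :
    CiliatedGraph.splitList m (l ++ l') =
      CiliatedGraph.splitList m l ++ CiliatedGraph.splitList m l' :=
  List.flatMap_append

theorem exists_splitList_eq {l : List E} {e : E} (he : e ∈ l) {k : ℕ} (hk : k + 1 < m e) :
    ∃ u v, CiliatedGraph.splitList m l =
      u ++ (⟨e, ⟨k, by omega⟩⟩ : Σ e, Fin (m e)) :: ⟨e, ⟨k + 1, hk⟩⟩ :: v := by
  obtain ⟨l1, l2, rfl⟩ := List.append_of_mem he
  obtain ⟨u, v, huv⟩ := exists_eq_append_of_succ hk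
  refine ⟨CiliatedGraph.splitList m l1 ++ u.map (Sigma.mk e),
    v.map (Sigma.mk e) ++ CiliatedGraph.splitList m l2, ?_⟩
  rw [splitList_append]
  have : CiliatedGraph.splitList m (e :: l2) =
      (List.finRange (m e)).map (Sigma.mk e) ++ CiliatedGraph.splitList m l2 := rfl
  rw [this, huv]
  simp

variable [DecidableEq E]

/-- The product of the coefficients of the codeterminants at all vertices of one color. -/
noncomputable def vertexWeight {X : Type*} (q : ℂ) (L : Fin N → List X) (ω : X → Fin n) : ℂ :=
  ∏ w, codet q ((L w).map ω)

/-- Consecutive copies are neighbours in the list of one vertex and absent from the others, so a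
single codeterminant acquires the factor `-q`. -/
theorem vertexWeight_comp_swap (q : ℂ) {v : E → Fin N} {L : Fin N → List E}
    (hL : ∀ w x, x ∈ L w ↔ v x = w) (hn : ∀ w, (L w).Nodup)
    (e : E) (k : ℕ) (hk : k + 1 < m e) (ω : (Σ e, Fin (m e)) → Fin n)
    (h : ω ⟨e, ⟨k, by omega⟩⟩ < ω ⟨e, ⟨k + 1, hk⟩⟩) :
    vertexWeight q (fun w => CiliatedGraph.splitList m (L w))
      (ω ∘ Equiv.swap ⟨e, ⟨k, by omega⟩⟩ ⟨e, ⟨k + 1, hk⟩⟩) =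
      -q * vertexWeight q (fun w => CiliatedGraph.splitList m (L w)) ω := by
  unfold vertexWeight
  have key : ∀ w, codet q ((CiliatedGraph.splitList m (L w)).map
      (ω ∘ Equiv.swap ⟨e, ⟨k, by omega⟩⟩ ⟨e, ⟨k + 1, hk⟩⟩)) =
      (if w = v e then -q else 1) * codet q ((CiliatedGraph.splitList m (L w)).map ω) := by
    intro w
    split_ifs with hw
    · obtain ⟨u1, u2, hu⟩ := exists_splitList_eq ((hL w e).2 hw.symm) hk
      have hnd := CiliatedGraph.nodup_splitList m _ (hn w)
      rw [hu] at hnd ⊢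
      rw [map_swap_comp ω hnd, codet_append_swap q _ _ h]
      simp
    · rw [one_mul]
      congr 1
      refine List.map_congr_left fun x hx => ?_
      rw [CiliatedGraph.mem_splitList, hL] at hx
      obtain ⟨e', k'⟩ := x
      refine comp_swap_of_ne ω e _ _ ?_ k'
      rintro rfl
      exact hw hx.symm
  simp only [key, Finset.prod_mul_distrib]
  simp

theorem vertexWeight_eq_zero (q : ℂ) {X : Type*} {L : Fin N → List X} {ω : X → Fin n} {x y : X}
    (hxy : x ≠ y) {w : Fin N} (hx : x ∈ L w) (hy : y ∈ L w) (h : ω x = ω y) :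
    vertexWeight q L ω = 0 := by
  refine Finset.prod_eq_zero (Finset.mem_univ w) (codet_eq_zero q fun H => hxy ?_)
  exact List.inj_on_of_nodup_map H hx hy h

theorem sum_eq_sum_lt_add_swap {X V : Type*} [Fintype X] [DecidableEq X] [AddCommMonoid V]
    (x y : X) (f : (X → Fin n) → V) (hf : ∀ β, β x = β y → f β = 0) :
    ∑ β, f β = ∑ β with β x < β y, (f β + f (β ∘ Equiv.swap x y)) := by
  have h1 : ∀ β, f β = (if β x < β y then f β else 0) + if β y < β x then f β else 0 := by
    intro β
    rcases lt_trichotomy (β x) (β y) with h | h | h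
    · simp [h, h.not_gt]
    · simp [h, hf β h]
    · simp [h, h.not_gt]
  have hinv : Function.Involutive fun β : X → Fin n => β ∘ Equiv.swap x y := by
    intro β; funext z; simp
  have h2 : ∑ β : X → Fin n, (if β y < β x then f β else 0) =
      ∑ β : X → Fin n, if β x < β y then f (β ∘ Equiv.swap x y) else 0 := by
    rw [← Equiv.sum_comp hinv.toPerm]
    simp
  rw [Finset.sum_congr rfl fun β _ => h1 β, Finset.sum_add_distrib, h2, Finset.sum_filter,
    ← Finset.sum_add_distrib]
  refine Finset.sum_congr rfl fun β _ => ?_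
  split_ifs <;> simp

variable {A : Type v} [Ring A] [Algebra ℂ A]

/-- Exchanging the rows of a quantum 2×2 minor multiplies it by `-q`. -/
theorem quantum_exchange {q : ℂ} (hq : q ≠ 0) {M : Matrix (Fin n) (Fin n) A}
    (hM : IsQuantumMatrix q M) {i k j l : Fin n} (hik : i < k) (hjl : j < l) :
    M k j * M i l - q • (M k l * M i j) = -q • (M i j * M k l - q • (M i l * M k j)) := by
  obtain ⟨-, -, -, -, h1, h2⟩ := hM i k j l hik hjl
  have h3 : M k l * M i j = M i j * M k l - (q - q⁻¹) • (M i l * M k j) := by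
    rw [← h2]; abel
  rw [h3, ← h1]
  have h4 : q * q⁻¹ = 1 := mul_inv_cancel₀ hq
  simp only [smul_sub, smul_smul, neg_smul, h4, sub_smul, neg_mul]
  simp only [one_smul]
  abel

/-- The ordered product of the matrix entries along a list of half-edges. -/
def entryProd {X : Type*} (l : List X) (Φ : X → Matrix (Fin n) (Fin n) A) (ω β : X → Fin n) : A :=
  (l.map fun x => Φ x (ω x) (β x)).prod

theorem entryProd_exchange {X : Type*} [DecidableEq X] {q : ℂ} (hq : q ≠ 0)
    {Φ : X → Matrix (Fin n) (Fin n) A} {u v : List X} {x y : X} (hΦ : Φ x = Φ y)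
    (hM : IsQuantumMatrix q (Φ x)) (hl : (u ++ x :: y :: v).Nodup) {ω β : X → Fin n}
    (hω : ω x < ω y) (hβ : β x < β y) :
    entryProd (u ++ x :: y :: v) Φ (ω ∘ Equiv.swap x y) β -
        q • entryProd (u ++ x :: y :: v) Φ (ω ∘ Equiv.swap x y) (β ∘ Equiv.swap x y) =
      -q • (entryProd (u ++ x :: y :: v) Φ ω β -
        q • entryProd (u ++ x :: y :: v) Φ ω (β ∘ Equiv.swap x y)) := by
  have h' := hl.perm (List.perm_middle.trans (List.perm_middle.cons x))
  simp only [List.nodup_cons, List.mem_cons, List.mem_append, not_or] at h'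
  obtain ⟨⟨hxy, hxu, hxv⟩, ⟨hyu, hyv⟩, -⟩ := h'
  have hs : ∀ (f : X → Fin n) (z : X), z ∈ u ∨ z ∈ v → (f ∘ Equiv.swap x y) z = f z := by
    intro f z hz
    rw [Function.comp_apply, Equiv.swap_apply_of_ne_of_ne]
    · rintro rfl; tauto
    · rintro rfl; tauto
  have hprod : ∀ ω' β' : X → Fin n, (∀ z, z ∈ u ∨ z ∈ v → ω' z = ω z) →
      (∀ z, z ∈ u ∨ z ∈ v → β' z = β z) → entryProd (u ++ x :: y :: v) Φ ω' β' =
      (u.map fun z => Φ z (ω z) (β z)).prod *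
        (Φ x (ω' x) (β' x) * Φ x (ω' y) (β' y)) * (v.map fun z => Φ z (ω z) (β z)).prod := by
    intro ω' β' h1 h2
    have hu : (u.map fun z => Φ z (ω' z) (β' z)) = u.map fun z => Φ z (ω z) (β z) :=
      List.map_congr_left fun z hz => by rw [h1 z (Or.inl hz), h2 z (Or.inl hz)]
    have hv : (v.map fun z => Φ z (ω' z) (β' z)) = v.map fun z => Φ z (ω z) (β z) :=
      List.map_congr_left fun z hz => by rw [h1 z (Or.inr hz), h2 z (Or.inr hz)]
    rw [entryProd, List.map_append, List.map_cons, List.map_cons, List.prod_append,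
      List.prod_cons, List.prod_cons, hu, hv, ← hΦ]
    simp only [mul_assoc]
  rw [hprod _ _ (hs ω) fun _ _ => rfl, hprod _ _ (hs ω) (hs β),
    hprod _ _ (fun _ _ => rfl) fun _ _ => rfl, hprod _ _ (fun _ _ => rfl) (hs β)]
  simp only [Function.comp_apply, Equiv.swap_apply_left, Equiv.swap_apply_right]
  have h := quantum_exchange hq hM hω hβ
  have hd : ∀ U P P' V : A, U * P * V - q • (U * P' * V) = U * (P - q • P') * V := by
    intro U P P' V
    simp only [mul_sub, sub_mul, mul_smul_comm, smul_mul_assoc]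
  rw [hd, hd, h]
  simp only [mul_smul_comm, smul_mul_assoc]

end Weights

/-! ### Reduction of the quantum trace to colorings that increase along every edge. -/

namespace CiliatedGraph

variable {E : Type u} {n N : ℕ}

/-- All edges, in the order of the lists of the white vertices. -/
def whiteList (G : CiliatedGraph N E) : List E := (List.ofFn G.whiteOrder).flatten

theorem mem_whiteList (G : CiliatedGraph N E) (e : E) : e ∈ G.whiteList := by
  rw [whiteList, List.mem_flatten]
  exact ⟨_, List.mem_ofFn.2 ⟨G.white e, rfl⟩, (G.mem_whiteOrder _ _).2 rfl⟩

theorem nodup_whiteList (G : CiliatedGraph N E) : G.whiteList.Nodup := by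
  rw [whiteList, List.nodup_flatten]
  constructor
  · intro l hl
    obtain ⟨w, rfl⟩ := List.mem_ofFn.1 hl
    exact G.nodup_whiteOrder w
  · rw [List.pairwise_ofFn]
    intro i j hij e hi hj
    rw [G.mem_whiteOrder] at hi hj
    exact hij.ne (hi.symm.trans hj)

theorem prod_ofFn_split {M : Type*} [Monoid M] (G : CiliatedGraph N E) (m : E → ℕ)
    (g : (Σ e, Fin (m e)) → M) :
    (List.ofFn fun w => (((G.split m).whiteOrder w).map g).prod).prod =
      ((splitList m G.whiteList).map g).prod := by
  have h : ∀ L : List (List E), (L.map fun l => ((splitList m l).map g).prod).prod =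
      ((splitList m L.flatten).map g).prod := by
    intro L
    induction L with
    | nil => rfl
    | cons l L ih =>
      rw [List.map_cons, List.prod_cons, ih, List.flatten_cons, splitList_append, List.map_append,
        List.prod_append]
  rw [whiteList, ← h, List.map_ofFn]
  rfl

variable {A : Type v} [Ring A] [Algebra ℂ A] [Fintype E] [DecidableEq E]

theorem quantumTrace_eq_sum_strictMono (G : CiliatedGraph N E) {q : ℂ} (hq : QAdmissible n q)
    {Φ : E → Matrix (Fin n) (Fin n) A} (hΦ : IsQuantumConnection q Φ) {m : E → ℕ}
    (hm : ∀ e, m e ≤ n) :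
    G.quantumTrace q Φ m = (∏ e, q ^ (m e).choose 2) •
      ∑ ω : (Σ e, Fin (m e)) → Fin n with ∀ e, StrictMono fun k => ω ⟨e, k⟩, ∑ β,
        (vertexWeight q (G.split m).blackOrder β * vertexWeight q (G.split m).whiteOrder ω) •
          entryProd (splitList m G.whiteList) (fun x => Φ x.1) ω β := by
  have h0 : (G.split m).properTrace q (fun x => Φ x.1) = ∑ ω, ∑ β,
      (vertexWeight q (G.split m).blackOrder β * vertexWeight q (G.split m).whiteOrder ω) •
          entryProd (splitList m G.whiteList) (fun x => Φ x.1) ω β := by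
    rw [properTrace, Finset.sum_comm]
    refine Finset.sum_congr rfl fun ω _ => Finset.sum_congr rfl fun β _ => ?_
    rw [prod_ofFn_split G m fun x => Φ x.1 (ω x) (β x)]
    rfl
  -- Pairing `β` with its swap, whose black weight carries `-q`, assembles quantum minors, to which
  -- the row exchange applies. The white weight supplies a second factor `-q` later.
  have hrow : ∀ (e : E) (k : ℕ) (hk : k + 1 < m e) (ω : (Σ e, Fin (m e)) → Fin n),
      ω ⟨e, ⟨k, by omega⟩⟩ < ω ⟨e, ⟨k + 1, hk⟩⟩ →
      ∑ β, vertexWeight q (G.split m).blackOrder β • entryProd (splitList m G.whiteList)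
        (fun x => Φ x.1) (ω ∘ Equiv.swap ⟨e, ⟨k, by omega⟩⟩ ⟨e, ⟨k + 1, hk⟩⟩) β =
      -q • ∑ β, vertexWeight q (G.split m).blackOrder β • entryProd (splitList m G.whiteList)
        (fun x => Φ x.1) ω β := by
    intro e k hk ω hω
    have hne : (⟨e, ⟨k, by omega⟩⟩ : Σ e, Fin (m e)) ≠ ⟨e, ⟨k + 1, hk⟩⟩ := by
      intro H; simp at H
    have hz : ∀ β : (Σ e, Fin (m e)) → Fin n, β ⟨e, ⟨k, by omega⟩⟩ = β ⟨e, ⟨k + 1, hk⟩⟩ →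
        vertexWeight q (G.split m).blackOrder β = 0 := fun β hβ =>
      vertexWeight_eq_zero q hne (w := G.black e) (((G.split m).mem_blackOrder _ _).2 rfl)
        (((G.split m).mem_blackOrder _ _).2 rfl) hβ
    rw [sum_eq_sum_lt_add_swap ⟨e, ⟨k, by omega⟩⟩ ⟨e, ⟨k + 1, hk⟩⟩ _
        (fun β hβ => by rw [hz β hβ, zero_smul]),
      sum_eq_sum_lt_add_swap ⟨e, ⟨k, by omega⟩⟩ ⟨e, ⟨k + 1, hk⟩⟩ _
        (fun β hβ => by rw [hz β hβ, zero_smul]), Finset.smul_sum]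
    refine Finset.sum_congr rfl fun β hβ => ?_
    have hβ' := (Finset.mem_filter.1 hβ).2
    have hs : vertexWeight q (G.split m).blackOrder
        (β ∘ Equiv.swap ⟨e, ⟨k, by omega⟩⟩ ⟨e, ⟨k + 1, hk⟩⟩) =
        -q * vertexWeight q (G.split m).blackOrder β :=
      vertexWeight_comp_swap q G.mem_blackOrder G.nodup_blackOrder e k hk β hβ'
    rw [hs]
    obtain ⟨u1, u2, hu⟩ := exists_splitList_eq (G.mem_whiteList e) hk
    have hnd := nodup_splitList m _ G.nodup_whiteList
    rw [hu] at hnd ⊢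
    have hx := entryProd_exchange hq.1 (Φ := fun x : Σ e, Fin (m e) => Φ x.1)
      (x := ⟨e, ⟨k, by omega⟩⟩) (y := ⟨e, ⟨k + 1, hk⟩⟩) rfl (hΦ.quantum e) hnd hω hβ'
    have hc : ∀ (c : ℂ) (a b : A), c • a + (-q * c) • b = c • (a - q • b) := by
      intro c a b
      rw [smul_sub, smul_smul, neg_mul, neg_smul, mul_comm q c, sub_eq_add_neg]
    rw [hc, hc, hx, smul_comm]
  have hsum := sum_eq_smul_sum_strictMono hq.1 (fun ω : (Σ e, Fin (m e)) → Fin n => ∑ β,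
      (vertexWeight q (G.split m).blackOrder β * vertexWeight q (G.split m).whiteOrder ω) •
          entryProd (splitList m G.whiteList) (fun x => Φ x.1) ω β) ?_ ?_
  · rw [quantumTrace, h0, hsum, smul_smul, Finset.prod_mul_distrib, mul_comm (∏ e, q ^ _),
      ← mul_assoc, inv_mul_cancel₀, one_mul]
    exact Finset.prod_ne_zero_iff.2 fun e _ => qFactorial_ne_zero hq (hm e)
  · intro e k hk ω hω
    have hs : vertexWeight q (G.split m).whiteOrder
        (ω ∘ Equiv.swap ⟨e, ⟨k, by omega⟩⟩ ⟨e, ⟨k + 1, hk⟩⟩) =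
        -q * vertexWeight q (G.split m).whiteOrder ω :=
      vertexWeight_comp_swap q G.mem_whiteOrder G.nodup_whiteOrder e k hk ω hω
    simp only [hs, mul_comm (vertexWeight q (G.split m).blackOrder _), mul_smul,
      ← Finset.smul_sum]
    rw [hrow e k hk ω hω]
    simp only [smul_smul]
    congr 1
    ring
  · intro ω hω
    obtain ⟨e, he⟩ := not_forall.1 hω
    obtain ⟨a, b, hab, hne⟩ := Function.not_injective_iff.1 he
    have hz : vertexWeight q (G.split m).whiteOrder ω = 0 :=
      vertexWeight_eq_zero q (x := ⟨e, a⟩) (y := ⟨e, b⟩) (by simpa using hne) (w := G.white e)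
        (((G.split m).mem_whiteOrder _ _).2 rfl) (((G.split m).mem_whiteOrder _ _).2 rfl) hab
    simp [hz]

end CiliatedGraph

/-! ### Reordering products along words -/

section Words

variable {n N : ℕ} {M : Type*} [Monoid M]

/-- Insertion only moves a factor past strictly smaller letters, and those are assumed to commute
with it. -/
theorem prod_map_insertionSort (h : Fin n → M) (c : List (Fin n))
    (hc : c.Pairwise fun a b => a ≤ b ∨ Commute (h a) (h b)) :
    ((c.insertionSort (· ≤ ·)).map h).prod = (c.map h).prod := by
  have hins : ∀ (a : Fin n) (c : List (Fin n)), (∀ b ∈ c, a ≤ b ∨ Commute (h a) (h b)) →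
      ((c.orderedInsert (· ≤ ·) a).map h).prod = h a * (c.map h).prod := by
    intro a c hc
    induction c with
    | nil => simp
    | cons b c ih =>
      rw [List.orderedInsert_cons]
      split_ifs with hab
      · simp
      · have hcomm := (hc b List.mem_cons_self).resolve_left hab
        rw [List.map_cons, List.prod_cons, ih fun b' hb' => hc b' (List.mem_cons_of_mem _ hb'),
          List.map_cons, List.prod_cons, ← mul_assoc, ← mul_assoc, hcomm.eq]
  induction c with
  | nil => rfl
  | cons a c ih =>
    rw [List.pairwise_cons] at hc
    rw [List.insertionSort_cons, hins, ih hc.2, List.map_cons, List.prod_cons]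
    intro b hb
    exact hc.1 b ((List.mem_insertionSort _).1 hb)

theorem toFinset_eq_univ {c : List (Fin n)} (hnd : c.Nodup) (hlen : c.length = n) :
    c.toFinset = Finset.univ := by
  apply Finset.eq_univ_of_card
  rw [List.toFinset_card_of_nodup hnd, hlen, Fintype.card_fin]

theorem prod_map_eq_prod_ofFn {X : Type*} {L : List X} {ω : X → Fin n} {g : X → M} {h : Fin n → M}
    (hgh : ∀ x ∈ L, h (ω x) = g x) (hnd : (L.map ω).Nodup) (hlen : (L.map ω).length = n)
    (hc : L.Pairwise fun x y => ω x ≤ ω y ∨ Commute (g x) (g y)) :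
    (L.map g).prod = (List.ofFn h).prod := by
  have h1 : L.map g = (L.map ω).map h := by
    rw [List.map_map]
    exact List.map_congr_left fun x hx => (hgh x hx).symm
  have h2 : (L.map ω).Pairwise fun a b => a ≤ b ∨ Commute (h a) (h b) := by
    rw [List.pairwise_map]
    refine hc.imp_of_mem fun {x y} hx hy hxy => ?_
    rwa [hgh x hx, hgh y hy]
  have h3 : (L.map ω).insertionSort (· ≤ ·) = List.finRange n := by
    refine List.Perm.eq_of_pairwise' (r := (· ≤ ·)) (List.pairwise_insertionSort _ _)
      (List.pairwise_le_finRange n) ?_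
    refine (List.perm_insertionSort _ _).trans
      ((List.perm_ext_iff_of_nodup hnd (List.nodup_finRange n)).2 fun a => ?_)
    rw [← List.mem_toFinset, toFinset_eq_univ hnd hlen]
    simp
  rw [h1, ← prod_map_insertionSort h _ h2, h3, List.ofFn_eq_map]

/-- The left side is the condition for no codeterminant to take its default value 0; the right side
says that each vertex of one color in the blow-up graph is covered exactly once. -/
theorem nodup_map_and_length_iff {X : Type*} (v : X → Fin N) {L : Fin N → List X}
    (hL : ∀ w x, x ∈ L w ↔ v x = w) (hn : ∀ w, (L w).Nodup) (ω : X → Fin n) :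
    (∀ w, ((L w).map ω).Nodup ∧ ((L w).map ω).length = n) ↔
      Function.Bijective fun x => (v x, ω x) := by
  constructor
  · intro h
    constructor
    · intro x y hxy
      obtain ⟨h1, h2⟩ := Prod.ext_iff.1 hxy
      exact List.inj_on_of_nodup_map (h (v y)).1 ((hL _ _).2 h1) ((hL _ _).2 rfl) h2
    · rintro ⟨w, i⟩
      have : i ∈ ((L w).map ω).toFinset := by
        rw [toFinset_eq_univ (h w).1 (h w).2]; exact Finset.mem_univ i
      rw [List.mem_toFinset, List.mem_map] at this
      obtain ⟨x, hx, rfl⟩ := this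
      exact ⟨x, Prod.ext ((hL _ _).1 hx) rfl⟩
  · intro h w
    have hnd : ((L w).map ω).Nodup := (hn w).map_on fun x hx y hy hxy =>
      h.1 (Prod.ext (((hL _ _).1 hx).trans ((hL _ _).1 hy).symm) hxy)
    refine ⟨hnd, ?_⟩
    rw [← List.toFinset_card_of_nodup hnd]
    have : ((L w).map ω).toFinset = Finset.univ := by
      refine Finset.eq_univ_of_forall fun i => ?_
      obtain ⟨x, hx⟩ := h.2 (w, i)
      obtain ⟨h1, h2⟩ := Prod.ext_iff.1 hx
      exact List.mem_toFinset.2 (List.mem_map.2 ⟨x, (hL _ _).2 h1, h2⟩)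
    rw [this, Finset.card_univ, Fintype.card_fin]

theorem vertexWeight_eq_pow {X : Type*} (q : ℂ) (v : X → Fin N) {L : Fin N → List X}
    (hL : ∀ w x, x ∈ L w ↔ v x = w) (hn : ∀ w, (L w).Nodup) {ω : X → Fin n}
    (h : Function.Bijective fun x => (v x, ω x)) :
    vertexWeight q L ω = (-q) ^ ∑ w, inversionCount ((L w).map ω) := by
  rw [← nodup_map_and_length_iff v hL hn] at h
  rw [vertexWeight, ← Finset.prod_pow_eq_pow_sum]
  exact Finset.prod_congr rfl fun w _ => if_pos (h w)

theorem bijective_of_vertexWeight_ne_zero {X : Type*} {q : ℂ} (v : X → Fin N) {L : Fin N → List X}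
    (hL : ∀ w x, x ∈ L w ↔ v x = w) (hn : ∀ w, (L w).Nodup) {ω : X → Fin n}
    (h : vertexWeight q L ω ≠ 0) : Function.Bijective fun x => (v x, ω x) := by
  rw [← nodup_map_and_length_iff v hL hn]
  intro w
  by_contra H
  exact h (Finset.prod_eq_zero (Finset.mem_univ w) (if_neg H))

theorem sort_image_eq {m : ℕ} {f : Fin m → Fin n} (hf : Function.Injective f) :
    (Finset.univ.image f).sort (· ≤ ·) = List.ofFn (f ∘ Tuple.sort f) := by
  refine List.Perm.eq_of_pairwise' (r := (· ≤ ·)) (Finset.pairwise_sort _ _) ?_ ?_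
  · rw [List.pairwise_ofFn]
    exact fun i j hij => Tuple.monotone_sort f hij.le
  · refine (List.perm_ext_iff_of_nodup (Finset.sort_nodup _ _)
      (List.nodup_ofFn.2 (hf.comp (Tuple.sort f).injective))).2 fun a => ?_
    rw [Finset.mem_sort, List.mem_ofFn]
    simp only [Finset.mem_image, Finset.mem_univ, true_and, Function.comp_apply]
    constructor
    · rintro ⟨i, rfl⟩
      exact ⟨(Tuple.sort f).symm i, by simp⟩
    · rintro ⟨i, rfl⟩
      exact ⟨_, rfl⟩

theorem pairwise_splitList {E : Type*} {m : E → ℕ} {R : (Σ e, Fin (m e)) → (Σ e, Fin (m e)) → Prop}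
    {l : List E} (h1 : ∀ e ∈ l, ∀ i j : Fin (m e), i < j → R ⟨e, i⟩ ⟨e, j⟩)
    (h2 : l.Pairwise fun e e' => ∀ i j, R ⟨e, i⟩ ⟨e', j⟩) :
    (CiliatedGraph.splitList m l).Pairwise R := by
  rw [CiliatedGraph.splitList, List.pairwise_flatMap]
  constructor
  · intro e he
    rw [List.pairwise_map]
    exact (List.pairwise_lt_finRange (m e)).imp fun {i j} hij => h1 e he i j hij
  · refine h2.imp fun {e e'} h x hx y hy => ?_
    rw [List.mem_map] at hx hy
    obtain ⟨i, -, rfl⟩ := hx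
    obtain ⟨j, -, rfl⟩ := hy
    exact h i j

end Words

/-! ### Dimer covers as pairs of colorings. -/

namespace CiliatedGraph.DimerCover

variable {E : Type u} {n N : ℕ} {G : CiliatedGraph N E} {m : E → ℕ}

/-- The dimer cover `D` consists of the edges given by the colors `ω` and `β` at the white and black
ends of the copies of the edges of `G`, the copies being numbered by increasing color `ω`. -/
structure IsColoredBy (D : G.DimerCover n) (ω β : (Σ e, Fin (m e)) → Fin n) : Prop where
  strictMono : ∀ e, StrictMono fun k => ω ⟨e, k⟩
  mem_iff : ∀ t, t ∈ D.1 ↔ ∃ x : Σ e, Fin (m e), (x.1, ω x, β x) = t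

namespace IsColoredBy

variable {D : G.DimerCover n} {ω β : (Σ e, Fin (m e)) → Fin n}

theorem mem (h : D.IsColoredBy ω β) (x : Σ e, Fin (m e)) : (x.1, ω x, β x) ∈ D.1 :=
  (h.mem_iff _).2 ⟨x, rfl⟩

theorem whiteEdge_eq (h : D.IsColoredBy ω β) (x : Σ e, Fin (m e)) :
    D.whiteEdge (G.white x.1, ω x) = (x.1, ω x, β x) :=
  (D.2.1 _ _).unique (D.whiteEdge_spec _) ⟨h.mem x, rfl, rfl⟩

theorem blackEdge_eq (h : D.IsColoredBy ω β) (x : Σ e, Fin (m e)) :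
    D.blackEdge (G.black x.1, β x) = (x.1, ω x, β x) :=
  (D.2.2 _ _).unique (D.blackEdge_spec _) ⟨h.mem x, rfl, rfl⟩

theorem edge_injective (h : D.IsColoredBy ω β) :
    Function.Injective fun x : Σ e, Fin (m e) => (x.1, ω x, β x) := by
  rintro ⟨e, k⟩ ⟨e', k'⟩ hxy
  simp only [Prod.mk.injEq] at hxy
  obtain ⟨rfl, hω, -⟩ := hxy
  rw [(h.strictMono e).injective hω]

theorem bijective_white (h : D.IsColoredBy ω β) :
    Function.Bijective fun x : Σ e, Fin (m e) => (G.white x.1, ω x) := by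
  constructor
  · intro x y hxy
    apply h.edge_injective
    simp only at hxy ⊢
    rw [← h.whiteEdge_eq x, ← h.whiteEdge_eq y, hxy]
  · intro p
    have hp := D.whiteEdge_spec p
    obtain ⟨x, hx⟩ := (h.mem_iff _).1 hp.1
    rw [← hx] at hp
    exact ⟨x, Prod.ext hp.2.1 hp.2.2⟩

theorem bijective_black (h : D.IsColoredBy ω β) :
    Function.Bijective fun x : Σ e, Fin (m e) => (G.black x.1, β x) := by
  constructor
  · intro x y hxy
    apply h.edge_injective
    simp only at hxy ⊢
    rw [← h.blackEdge_eq x, ← h.blackEdge_eq y, hxy]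
  · intro p
    have hp := D.blackEdge_spec p
    obtain ⟨x, hx⟩ := (h.mem_iff _).1 hp.1
    rw [← hx] at hp
    exact ⟨x, Prod.ext hp.2.1 hp.2.2⟩

theorem perm_eq (h : D.IsColoredBy ω β) (x : Σ e, Fin (m e)) :
    D.perm (G.white x.1, ω x) = (G.black x.1, β x) := by
  change (G.black (D.whiteEdge (G.white x.1, ω x)).1, (D.whiteEdge (G.white x.1, ω x)).2.2) = _
  rw [h.whiteEdge_eq]

theorem black_injective (h : D.IsColoredBy ω β) (e : E) :
    Function.Injective fun k => β ⟨e, k⟩ := by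
  intro i j hij
  have := h.bijective_black.1 (a₁ := ⟨e, i⟩) (a₂ := ⟨e, j⟩) (Prod.ext rfl hij)
  simpa using this

/-- A strictly increasing map is determined by its range, and each white color then determines its
dimer. -/
theorem unique (h : D.IsColoredBy ω β) {ω' β' : (Σ e, Fin (m e)) → Fin n}
    (h' : D.IsColoredBy ω' β') : ω = ω' ∧ β = β' := by
  have hω : ω = ω' := by
    have hsub : ∀ {ω β ω' β' : (Σ e, Fin (m e)) → Fin n}, D.IsColoredBy ω β →
        D.IsColoredBy ω' β' →
        ∀ e, Set.range (fun k => ω ⟨e, k⟩) ⊆ Set.range fun k => ω' ⟨e, k⟩ := by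
      rintro ω β ω' β' h h' e _ ⟨k, rfl⟩
      obtain ⟨⟨e', k'⟩, hx⟩ := (h'.mem_iff _).1 (h.mem ⟨e, k⟩)
      simp only [Prod.mk.injEq] at hx
      obtain ⟨rfl, hx, -⟩ := hx
      exact ⟨k', hx⟩
    funext ⟨e, k⟩
    exact congrFun ((StrictMono.range_inj (h.strictMono e) (h'.strictMono e)).1
      ((hsub h h' e).antisymm (hsub h' h e))) k
  subst hω
  refine ⟨rfl, funext fun x => ?_⟩
  have := (h.whiteEdge_eq x).symm.trans (h'.whiteEdge_eq x)
  simpa using this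

theorem eq_of_eq (h : D.IsColoredBy ω β) {D' : G.DimerCover n} (h' : D'.IsColoredBy ω β) :
    D = D' :=
  Subtype.ext (Finset.ext fun t => (h.mem_iff t).trans (h'.mem_iff t).symm)

theorem exists_of_bijective [Fintype E] [DecidableEq E] (hω : ∀ e, StrictMono fun k => ω ⟨e, k⟩)
    (hw : Function.Bijective fun x : Σ e, Fin (m e) => (G.white x.1, ω x))
    (hb : Function.Bijective fun x : Σ e, Fin (m e) => (G.black x.1, β x)) :
    ∃ D : G.DimerCover n, D.IsColoredBy ω β := by
  refine ⟨⟨Finset.univ.image fun x : Σ e, Fin (m e) => (x.1, ω x, β x), ?_, ?_⟩, hω, ?_⟩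
  · intro w i
    obtain ⟨x, hx⟩ := hw.2 (w, i)
    obtain ⟨h1, h2⟩ := Prod.ext_iff.1 hx
    refine ⟨(x.1, ω x, β x), ⟨Finset.mem_image_of_mem _ (Finset.mem_univ x), h1, h2⟩, ?_⟩
    rintro _ ⟨ht, h3, h4⟩
    obtain ⟨y, -, rfl⟩ := Finset.mem_image.1 ht
    rw [hw.1 (a₁ := y) (a₂ := x) (Prod.ext (h3.trans h1.symm) (h4.trans h2.symm))]
  · intro b j
    obtain ⟨x, hx⟩ := hb.2 (b, j)
    obtain ⟨h1, h2⟩ := Prod.ext_iff.1 hx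
    refine ⟨(x.1, ω x, β x), ⟨Finset.mem_image_of_mem _ (Finset.mem_univ x), h1, h2⟩, ?_⟩
    rintro _ ⟨ht, h3, h4⟩
    obtain ⟨y, -, rfl⟩ := Finset.mem_image.1 ht
    rw [hb.1 (a₁ := y) (a₂ := x) (Prod.ext (h3.trans h1.symm) (h4.trans h2.symm))]
  · intro t
    simp

variable [DecidableEq E]

theorem filter_eq (h : D.IsColoredBy ω β) (e : E) :
    (D.1.filter fun t => t.1 = e) = Finset.univ.image fun k => (e, ω ⟨e, k⟩, β ⟨e, k⟩) := by
  ext t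
  rw [Finset.mem_filter, h.mem_iff, Finset.mem_image]
  constructor
  · rintro ⟨⟨⟨e', k⟩, rfl⟩, rfl⟩
    exact ⟨k, Finset.mem_univ _, rfl⟩
  · rintro ⟨k, -, rfl⟩
    exact ⟨⟨⟨e, k⟩, rfl⟩, rfl⟩

theorem mult_eq (h : D.IsColoredBy ω β) (e : E) : D.mult e = m e := by
  rw [mult, h.filter_eq, Finset.card_image_of_injective, Finset.card_univ, Fintype.card_fin]
  intro i j hij
  simp only [Prod.mk.injEq] at hij
  exact (h.strictMono e).injective hij.2.1

theorem whiteColors_eq (h : D.IsColoredBy ω β) (e : E) :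
    D.whiteColors e = Finset.univ.image fun k => ω ⟨e, k⟩ := by
  rw [whiteColors, h.filter_eq, Finset.image_image]
  rfl

theorem blackColors_eq (h : D.IsColoredBy ω β) (e : E) :
    D.blackColors e = Finset.univ.image fun k => β ⟨e, k⟩ := by
  rw [blackColors, h.filter_eq, Finset.image_image]
  rfl

theorem sort_whiteColors (h : D.IsColoredBy ω β) (e : E) :
    (D.whiteColors e).sort (· ≤ ·) = List.ofFn fun k => ω ⟨e, k⟩ := by
  rw [h.whiteColors_eq, sort_image_eq (h.strictMono e).injective,
    Tuple.sort_eq_refl_iff_monotone.2 (h.strictMono e).monotone]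
  rfl

theorem edgeWord_eq (h : D.IsColoredBy ω β) (e : E) :
    D.edgeWord e = List.ofFn fun k => β ⟨e, k⟩ := by
  rw [edgeWord, h.sort_whiteColors, List.map_ofFn]
  congr 1
  funext k
  exact congrArg Prod.snd (h.perm_eq ⟨e, k⟩)

theorem whiteWord_eq (h : D.IsColoredBy ω β) (w : Fin N) :
    D.whiteWord w = ((G.split m).whiteOrder w).map ω := by
  change _ = (splitList m (G.whiteOrder w)).map ω
  rw [whiteWord, splitList, List.map_flatMap]
  simp only [h.sort_whiteColors, List.map_map, List.ofFn_eq_map]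
  rfl

/-- Only `ω` increases along each edge, so the black colors have to be sorted first; the inversions
lost this way are those of the edge words. -/
theorem blackWord_eq (h : D.IsColoredBy ω β) (b : Fin N) :
    D.blackWord b = ((G.split m).blackOrder b).map (splitSort β) := by
  change _ = (splitList m (G.blackOrder b)).map (splitSort β)
  rw [blackWord, splitList, List.map_flatMap]
  simp only [h.blackColors_eq, sort_image_eq (h.black_injective _), List.map_map,
    List.ofFn_eq_map]
  rfl

end IsColoredBy

theorem exists_isColoredBy [DecidableEq E] (D : G.DimerCover n) (hD : ∀ e, D.mult e = m e) :
    ∃ ω β : (Σ e, Fin (m e)) → Fin n, D.IsColoredBy ω β := by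
  have hcard : ∀ e, (D.whiteColors e).card = m e := by
    intro e
    rw [← hD e, whiteColors, Finset.card_image_of_injOn, mult]
    intro s hs t ht hst
    simp only [Finset.coe_filter, Set.mem_ofPred_eq] at hs ht
    refine (D.2.1 (G.white e) t.2.1).unique ⟨hs.1, by rw [hs.2], hst⟩ ⟨ht.1, by rw [ht.2], rfl⟩
  -- The copies of an edge are numbered by increasing white color, as `IsColoredBy` requires.
  let ω : (Σ e, Fin (m e)) → Fin n := fun x => (D.whiteColors x.1).orderEmbOfFin (hcard x.1) x.2
  have hω : ∀ x, D.whiteEdge (G.white x.1, ω x) =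
      (x.1, ω x, (D.whiteEdge (G.white x.1, ω x)).2.2) := by
    intro x
    have h1 : ω x ∈ D.whiteColors x.1 := Finset.orderEmbOfFin_mem _ _ _
    rw [whiteColors, Finset.mem_image] at h1
    obtain ⟨t, ht, h2⟩ := h1
    rw [Finset.mem_filter] at ht
    have h3 : D.whiteEdge (G.white x.1, ω x) = t :=
      (D.2.1 _ _).unique (D.whiteEdge_spec _) ⟨ht.1, by rw [ht.2], h2⟩
    rw [h3]
    exact Prod.ext ht.2 (Prod.ext h2 rfl)
  refine ⟨ω, fun x => (D.whiteEdge (G.white x.1, ω x)).2.2, ?_, fun t => ⟨fun ht => ?_, ?_⟩⟩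
  · exact fun e => ((D.whiteColors e).orderEmbOfFin (hcard e)).strictMono
  · have h1 : t.2.1 ∈ Set.range ((D.whiteColors t.1).orderEmbOfFin (hcard t.1)) := by
      rw [Finset.range_orderEmbOfFin]
      exact Finset.mem_image_of_mem _ (Finset.mem_filter.2 ⟨ht, rfl⟩)
    obtain ⟨k, hk⟩ := h1
    refine ⟨⟨t.1, k⟩, ?_⟩
    rw [← hω ⟨t.1, k⟩]
    exact (D.2.1 _ _).unique (D.whiteEdge_spec _) ⟨ht, rfl, hk.symm⟩
  · rintro ⟨x, rfl⟩
    rw [← hω x]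
    exact (D.whiteEdge_spec _).1

end CiliatedGraph.DimerCover

namespace CiliatedGraph

variable {E : Type u} {n N : ℕ} {m : E → ℕ}

namespace DimerCover.IsColoredBy

variable {G : CiliatedGraph N E} {D : G.DimerCover n} {ω β : (Σ e, Fin (m e)) → Fin n}

theorem prod_sign [Fintype E] (h : D.IsColoredBy ω β) (ε : E → ℤˣ) :
    ∏ p : Fin N × Fin n, ε (D.whiteEdge p).1 = ∏ e, ε e ^ m e := by
  rw [← (Equiv.ofBijective _ h.bijective_white).prod_comp]
  simp only [Equiv.ofBijective_apply, h.whiteEdge_eq, Fintype.prod_sigma, Finset.prod_const,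
    Finset.card_univ, Fintype.card_fin]

variable {A : Type v} [Ring A] [Algebra ℂ A]

/-- Passing from the order of the half-edges to the order of the colors at a white vertex only moves
entries on different edges past each other, since along one edge the colors already increase. -/
theorem entryProd_eq (h : D.IsColoredBy ω β) {q : ℂ} {Φ : E → Matrix (Fin n) (Fin n) A}
    (hΦ : IsQuantumConnection q Φ) :
    entryProd (splitList m G.whiteList) (fun x => Φ x.1) ω β =
      (List.ofFn fun w : Fin N => (List.ofFn fun i : Fin n =>
        Φ (D.whiteEdge (w, i)).1 (D.whiteEdge (w, i)).2.1 (D.whiteEdge (w, i)).2.2).prod).prod := by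
  rw [entryProd, ← prod_ofFn_split]
  congr 2
  funext w
  have hw := (nodup_map_and_length_iff (fun x : Σ e, Fin (m e) => G.white x.1)
    (G.split m).mem_whiteOrder (G.split m).nodup_whiteOrder ω).2 h.bijective_white w
  refine prod_map_eq_prod_ofFn (ω := ω) ?_ hw.1 hw.2 ?_
  · intro x hx
    have hx' : G.white x.1 = w := ((G.split m).mem_whiteOrder w x).1 hx
    rw [← hx', h.whiteEdge_eq]
  · refine pairwise_splitList (fun e _ i j hij => Or.inl (h.strictMono e hij).le) ?_
    exact (G.nodup_whiteOrder w).imp fun hne i j => Or.inr (hΦ.commute _ _ hne _ _ _ _)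

end DimerCover.IsColoredBy

theorem mult_le [DecidableEq E] (G : CiliatedGraph N E) (D : G.DimerCover n) (e : E) :
    D.mult e ≤ n := by
  obtain ⟨ω, β, h⟩ := D.exists_isColoredBy fun _ => rfl
  simpa using Fintype.card_le_of_injective _ (h.strictMono e).injective

/-! ### The sign of a dimer cover -/

/-- The order of the copies of the edges induced by an order of the edges. -/
def splitKey {α : Type*} (k : E → α) (x : Σ e, Fin (m e)) : α ×ₗ ℕ := toLex (k x.1, (x.2 : ℕ))

theorem splitKey_injective {α : Type*} {k : E → α} (hk : Function.Injective k) :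
    Function.Injective (splitKey (m := m) k) := by
  rintro ⟨e, i⟩ ⟨e', j⟩ h
  obtain ⟨h1, h2⟩ := Prod.ext_iff.1 (toLex.injective h)
  simp only at h1 h2
  obtain rfl := hk h1
  rw [Fin.ext h2]

theorem splitKey_lt_of_lt {α : Type*} [LinearOrder α] {k : E → α} {x y : Σ e, Fin (m e)}
    (h : k x.1 < k y.1) : splitKey k x < splitKey k y :=
  Prod.Lex.toLex_lt_toLex.2 (Or.inl h)

theorem pairwise_splitKey [DecidableEq E] {v : E → Fin N} {L : Fin N → List E}
    (hL : ∀ w x, x ∈ L w ↔ v x = w) (hn : ∀ w, (L w).Nodup) (w : Fin N) :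
    (splitList m (L w)).Pairwise fun x y =>
      splitKey (vertexKey v L) x < splitKey (vertexKey v L) y := by
  refine pairwise_splitList (fun e _ i j hij => Prod.Lex.toLex_lt_toLex.2 (Or.inr ⟨rfl, hij⟩)) ?_
  refine (pairwise_vertexKey hL hn w).imp fun {e e'} h i j => ?_
  exact splitKey_lt_of_lt (x := ⟨e, i⟩) (y := ⟨e', j⟩) h

variable [Fintype E]

/-- Copies of one edge come in the same order in both keys, while a discordant pair of edges `e`,
`f` yields `m e * m f` discordant pairs of copies. -/
theorem discord_splitKey {α β : Type*} [LinearOrder α] [LinearOrder β] {k : E → α} {l : E → β}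
    (hk : Function.Injective k) (hl : Function.Injective l) :
    discord (splitKey (m := m) k) (splitKey l) = crossingForm k l fun e => (m e : ZMod 2) := by
  unfold discord crossingForm
  rw [Fintype.sum_sigma]
  refine Finset.sum_congr rfl fun e _ => ?_
  have h : ∀ i : Fin (m e), ∀ y : Σ e, Fin (m e),
      (splitKey k ⟨e, i⟩ < splitKey k y ∧ splitKey l y < splitKey l ⟨e, i⟩) ↔
        (k e < k y.1 ∧ l y.1 < l e) := by
    rintro i ⟨f, j⟩
    unfold splitKey
    rw [Prod.Lex.toLex_lt_toLex, Prod.Lex.toLex_lt_toLex]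
    simp only
    constructor
    · rintro ⟨h1 | ⟨h1, h1'⟩, h2 | ⟨h2, h2'⟩⟩
      · exact ⟨h1, h2⟩
      · rw [hl h2] at h1; exact absurd h1 (lt_irrefl _)
      · rw [hk h1] at h2; exact absurd h2 (lt_irrefl _)
      · omega
    · exact fun h => ⟨Or.inl h.1, Or.inl h.2⟩
  simp only [h, Fintype.sum_sigma]
  rw [Finset.sum_const, Finset.card_univ, Fintype.card_fin, nsmul_eq_mul, Finset.mul_sum]
  refine Finset.sum_congr rfl fun f _ => ?_
  by_cases H : k e < k f ∧ l f < l e <;> simp [H]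

variable [DecidableEq E]

theorem sum_inversionCount_split {v : E → Fin N} {L : Fin N → List E}
    (hL : ∀ w x, x ∈ L w ↔ v x = w) (hn : ∀ w, (L w).Nodup) (ω : (Σ e, Fin (m e)) → Fin n) :
    ((∑ w, inversionCount ((splitList m (L w)).map ω) : ℕ) : ZMod 2) =
      discord (splitKey (vertexKey v L)) fun x => toLex (v x.1, ω x) :=
  sum_inversionCount_eq_discord (fun x : Σ e, Fin (m e) => v x.1)
    (fun w => splitList m (L w)) (fun w x => by rw [mem_splitList, hL]) _
    (pairwise_splitKey hL hn) (fun _ _ h => splitKey_lt_of_lt (vertexKey_lt_of_lt _ _ h)) ω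

namespace DimerCover.IsColoredBy

variable {G : CiliatedGraph N E} {D : G.DimerCover n} {ω β : (Σ e, Fin (m e)) → Fin n}

/-- The cocycle rule runs from white labels to black labels through the two list orders; the
end-to-end discordance is the sign of `D.perm`, and the middle step is the crossing form. -/
theorem neg_one_pow_inversions (h : D.IsColoredBy ω β) :
    (-1 : ℤˣ) ^ (∑ b, inversionCount (((G.split m).blackOrder b).map β) +
        ∑ w, inversionCount (((G.split m).whiteOrder w).map ω)) =
      Equiv.Perm.sign D.perm * (-1) ^ G.crossing fun e => (m e : ZMod 2) := by
  have hw : ((∑ w, inversionCount (((G.split m).whiteOrder w).map ω) : ℕ) : ZMod 2) = _ :=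
    sum_inversionCount_split G.mem_whiteOrder G.nodup_whiteOrder ω
  have hb : ((∑ b, inversionCount (((G.split m).blackOrder b).map β) : ℕ) : ZMod 2) = _ :=
    sum_inversionCount_split G.mem_blackOrder G.nodup_blackOrder β
  let a : (Σ e, Fin (m e)) ≃ Fin N × Fin n := Equiv.ofBijective _ h.bijective_white
  have hkW := splitKey_injective (m := m) (vertexKey_injective G.mem_whiteOrder)
  have hkB := splitKey_injective (m := m) (vertexKey_injective G.mem_blackOrder)
  have hω : Function.Injective fun x : Σ e, Fin (m e) => toLex (G.white x.1, ω x) :=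
    toLex.injective.comp h.bijective_white.1
  have hβ : Function.Injective fun x : Σ e, Fin (m e) => toLex (G.black x.1, β x) :=
    toLex.injective.comp h.bijective_black.1
  have hsign : discord (fun x : Σ e, Fin (m e) => toLex (G.white x.1, ω x))
      (fun x => toLex (G.black x.1, β x)) =
      discord (toLex : Fin N × Fin n → _) (toLex ∘ D.perm) := by
    rw [← discord_comp_equiv a]
    congr 1
    funext x
    exact congrArg toLex (h.perm_eq x).symm
  have htotal : discord (fun x : Σ e, Fin (m e) => toLex (G.white x.1, ω x))
      (fun x => toLex (G.black x.1, β x)) =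
      discord (splitKey (m := m) G.whiteKey) (fun x => toLex (G.white x.1, ω x)) +
        G.crossing (fun e => (m e : ZMod 2)) +
        discord (splitKey (m := m) G.blackKey) (fun x => toLex (G.black x.1, β x)) := by
    rw [crossing, ← discord_splitKey (k := G.whiteKey) (l := G.blackKey)
      (vertexKey_injective G.mem_whiteOrder) (vertexKey_injective G.mem_blackOrder),
      discord_comm (splitKey G.whiteKey) fun x => toLex (G.white x.1, ω x),
      ← discord_add_discord hω hkB hβ, ← discord_add_discord hω hkW hkB]
    rfl
  rw [sign_eq_discord toLex.injective, ← hsign, htotal, ← uzpow_add, ← uzpow_natCast (R := ZMod 2)]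
  congr 1
  push_cast at hw hb ⊢
  rw [whiteKey, blackKey, ← hw, ← hb]
  have := CharTwo.add_self_eq_zero (G.crossing fun e => (m e : ZMod 2))
  linear_combination (exp := 1) -this

theorem sum_inversionCount_black (h : D.IsColoredBy ω β) :
    ∑ b, inversionCount (((G.split m).blackOrder b).map β) =
      splitInv β + ∑ b, inversionCount (D.blackWord b) := by
  -- At `q = -2` a nonzero vertex weight is 2 to the number of inversions, so comparing weights
  -- under sorting compares exponents.
  have hswap := eq_pow_splitInv_smul (V := ℂ) (-(-2))
    (fun β : (Σ e, Fin (m e)) → Fin n => vertexWeight (-2) (G.split m).blackOrder β)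
    (fun e k hk ω h => vertexWeight_comp_swap (-2) G.mem_blackOrder G.nodup_blackOrder e k hk ω h) β
  have hne : vertexWeight (-2) (G.split m).blackOrder β ≠ 0 := by
    rw [vertexWeight_eq_pow (-2) _ (G.split m).mem_blackOrder (G.split m).nodup_blackOrder
      h.bijective_black]
    exact pow_ne_zero _ (by norm_num)
  have hne' : vertexWeight (-2) (G.split m).blackOrder (splitSort β) ≠ 0 := by
    intro H
    rw [H, smul_zero] at hswap
    exact hne hswap
  rw [vertexWeight_eq_pow (-2) _ (G.split m).mem_blackOrder (G.split m).nodup_blackOrder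
      h.bijective_black, vertexWeight_eq_pow (-2) _ (G.split m).mem_blackOrder
      (G.split m).nodup_blackOrder (bijective_of_vertexWeight_ne_zero _
      (G.split m).mem_blackOrder (G.split m).nodup_blackOrder hne'), smul_eq_mul, ← pow_add,
      neg_neg] at hswap
  simp only [h.blackWord_eq]
  exact Nat.pow_right_injective le_rfl (by exact_mod_cast hswap)

theorem vertex_sums (h : D.IsColoredBy ω β) :
    (∀ b, ∑ e ∈ Finset.univ.filter (fun e => G.black e = b), m e = n) ∧
      ∀ w, ∑ e ∈ Finset.univ.filter (fun e => G.white e = w), m e = n := by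
  have key : ∀ (v : E → Fin N) (L : Fin N → List E), (∀ w x, x ∈ L w ↔ v x = w) →
      (∀ w, (L w).Nodup) → ∀ f : (Σ e, Fin (m e)) → Fin n,
      (Function.Bijective fun x : Σ e, Fin (m e) => (v x.1, f x)) →
      ∀ w, ∑ e ∈ Finset.univ.filter (fun e => v e = w), m e = n := by
    intro v L hL hn f hf w
    have h1 := ((nodup_map_and_length_iff (fun x : Σ e, Fin (m e) => v x.1)
      (L := fun w => splitList m (L w)) (fun w x => by rw [mem_splitList, hL])
      (fun w => nodup_splitList m _ (hn w)) f).2 hf w).2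
    have h2 : (L w).toFinset = Finset.univ.filter fun e => v e = w := by ext e; simp [hL]
    rw [← h2, List.sum_toFinset _ (hn w)]
    simpa [splitList, List.length_flatMap] using h1
  exact ⟨key _ _ G.mem_blackOrder G.nodup_blackOrder β h.bijective_black,
    key _ _ G.mem_whiteOrder G.nodup_whiteOrder ω h.bijective_white⟩

end DimerCover.IsColoredBy

/-! ### The partition function and the Kasteleyn determinant -/

/-- Choosing the coloring of each cover is injective, and by `IsColoredBy.unique` it reaches every
colored pair; the remaining pairs contribute nothing. -/
theorem sum_dimerCover_eq {V : Type*} [AddCommMonoid V] (G : CiliatedGraph N E) (m : E → ℕ)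
    (f : G.DimerCover n → V) (g : ((Σ e, Fin (m e)) → Fin n) → ((Σ e, Fin (m e)) → Fin n) → V)
    (hfg : ∀ D ω β, D.IsColoredBy ω β → f D = g ω β)
    (hg : ∀ ω β, (∀ e, StrictMono fun k => ω ⟨e, k⟩) →
      (¬ ∃ D : G.DimerCover n, D.IsColoredBy ω β) → g ω β = 0) :
    ∑ D with D.mult = m, f D = ∑ ω with (∀ e, StrictMono fun k => ω ⟨e, k⟩), ∑ β, g ω β := by
  classical
  rw [← Finset.sum_product']
  refine Eq.trans ?_ (Finset.sum_filter_of_ne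
    (p := fun x => ∃ D : G.DimerCover n, D.IsColoredBy x.1 x.2) ?_)
  · have hex : ∀ D ∈ Finset.univ.filter (fun D : G.DimerCover n => D.mult = m),
        ∃ x : ((Σ e, Fin (m e)) → Fin n) × ((Σ e, Fin (m e)) → Fin n),
          D.IsColoredBy x.1 x.2 := by
      intro D hD
      obtain ⟨ω, β, h⟩ := D.exists_isColoredBy (congrFun (Finset.mem_filter.1 hD).2)
      exact ⟨(ω, β), h⟩
    choose c hc using hex
    refine Finset.sum_bij c ?_ ?_ ?_ ?_
    · intro D hD
      simp only [Finset.mem_filter, Finset.mem_product, Finset.mem_univ, true_and, and_true]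
      exact ⟨(hc D hD).strictMono, D, hc D hD⟩
    · intro D hD D' hD' h
      have h' := hc D' hD'
      rw [← h] at h'
      exact (hc D hD).eq_of_eq h'
    · intro x hx
      obtain ⟨-, D, hD⟩ := Finset.mem_filter.1 hx
      have hDm : D ∈ Finset.univ.filter fun D : G.DimerCover n => D.mult = m :=
        Finset.mem_filter.2 ⟨Finset.mem_univ _, funext hD.mult_eq⟩
      obtain ⟨h1, h2⟩ := (hc D hDm).unique hD
      exact ⟨D, hDm, Prod.ext h1 h2⟩
    · intro D hD
      exact hfg D _ _ (hc D hD)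
  · intro x hx hne
    by_contra H
    simp only [Finset.mem_product, Finset.mem_filter, Finset.mem_univ, true_and, and_true] at hx
    exact hne (hg _ _ hx H)

theorem sum_dimerCover_eq_sum_multiwebs {V : Type*} [AddCommMonoid V] (G : CiliatedGraph N E)
    (f : G.DimerCover n → V) :
    ∑ D, f D = ∑ m ∈ G.multiwebs n, ∑ D with D.mult = fun e => (m e : ℕ), f D := by
  classical
  let c : G.DimerCover n → E → Fin (n + 1) := fun D e =>
    ⟨D.mult e, Nat.lt_succ_of_le (G.mult_le D e)⟩
  have hc : ∀ D ∈ Finset.univ, c D ∈ G.multiwebs n := by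
    intro D _
    obtain ⟨ω, β, h⟩ := D.exists_isColoredBy fun _ => rfl
    exact Finset.mem_filter.2 ⟨Finset.mem_univ _, h.vertex_sums⟩
  rw [← Finset.sum_fiberwise_of_maps_to hc]
  refine Finset.sum_congr rfl fun m _ => Finset.sum_congr ?_ fun _ _ => rfl
  ext D
  simp only [Finset.mem_filter, Finset.mem_univ, true_and, c, funext_iff, Fin.ext_iff]

variable {A : Type v} [Ring A] [Algebra ℂ A]

theorem quantumTrace_eq_sum_dimerCover (G : CiliatedGraph N E) {ε : E → ℤˣ} {s : ℤˣ}
    (hs : (-1) ^ G.crossing (fun e => (m e : ZMod 2)) = s * ∏ e, ε e ^ m e) {q : ℂ}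
    (hq : QAdmissible n q) {Φ : E → Matrix (Fin n) (Fin n) A} (hΦ : IsQuantumConnection q Φ)
    (hm : ∀ e, m e ≤ n) :
    G.quantumTrace q Φ m = (s : ℤ) • ∑ D : G.DimerCover n with D.mult = m,
      ((((Equiv.Perm.sign D.perm : ℤˣ) : ℤ) : ℂ) *
        ((∏ b, q ^ inversionCount (D.blackWord b)) * (∏ w, q ^ inversionCount (D.whiteWord w))) *
        (∏ e, q ^ (D.mult e).choose 2 * q ^ inversionCount (D.edgeWord e)) *
        (∏ p : Fin N × Fin n, (((ε (D.whiteEdge p).1 : ℤˣ) : ℤ) : ℂ))) •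
      (List.ofFn fun w : Fin N => (List.ofFn fun i : Fin n =>
        Φ (D.whiteEdge (w, i)).1 (D.whiteEdge (w, i)).2.1 (D.whiteEdge (w, i)).2.2).prod).prod := by
  rw [G.quantumTrace_eq_sum_strictMono hq hΦ hm, Finset.smul_sum, Finset.smul_sum]
  simp only [Finset.smul_sum]
  refine (G.sum_dimerCover_eq m _ _ ?_ ?_).symm
  · intro D ω β h
    rw [h.entryProd_eq hΦ, ← Int.cast_smul_eq_zsmul ℂ, smul_smul, smul_smul]
    congr 1
    rw [vertexWeight_eq_pow q _ (G.split m).mem_blackOrder (G.split m).nodup_blackOrder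
        h.bijective_black, vertexWeight_eq_pow q _ (G.split m).mem_whiteOrder
        (G.split m).nodup_whiteOrder h.bijective_white, ← pow_add, neg_pow]
    have hsign : ((-1 : ℂ)) ^ (∑ b, inversionCount (((G.split m).blackOrder b).map β) +
        ∑ w, inversionCount (((G.split m).whiteOrder w).map ω)) =
        (((Equiv.Perm.sign D.perm : ℤˣ) : ℤ) : ℂ) * (((s : ℤˣ) : ℤ) *
          ∏ p : Fin N × Fin n, (((ε (D.whiteEdge p).1 : ℤˣ) : ℤ) : ℂ)) := by
      have h1 := h.neg_one_pow_inversions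
      rw [hs, ← h.prod_sign] at h1
      have h2 := congrArg (fun z : ℤˣ => ((z : ℤ) : ℂ)) h1
      -- The Kasteleyn identity `hs` has turned the crossing sign into `s` times the product of the
      -- signs along the dimers.
      simpa using h2
    rw [hsign, pow_add, h.sum_inversionCount_black, pow_add, Finset.prod_mul_distrib,
      Finset.prod_pow_eq_pow_sum, Finset.prod_pow_eq_pow_sum, Finset.prod_pow_eq_pow_sum,
      Finset.prod_pow_eq_pow_sum]
    simp only [h.mult_eq, h.edgeWord_eq, h.whiteWord_eq]
    rw [splitInv, Finset.prod_pow_eq_pow_sum]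
    ring
  · intro ω β hω hne
    have hz : vertexWeight q (G.split m).blackOrder β *
        vertexWeight q (G.split m).whiteOrder ω = 0 := by
      by_contra H
      obtain ⟨hb, hw⟩ := mul_ne_zero_iff.1 H
      exact hne (DimerCover.IsColoredBy.exists_of_bijective hω
        (bijective_of_vertexWeight_ne_zero _ (G.split m).mem_whiteOrder
          (G.split m).nodup_whiteOrder hw)
        (bijective_of_vertexWeight_ne_zero _ (G.split m).mem_blackOrder
          (G.split m).nodup_blackOrder hb))
    rw [hz, zero_smul, smul_zero]

end CiliatedGraph

theorem theorem3 {N n : ℕ} (hn : 1 ≤ n) {E : Type u} [Fintype E] [DecidableEq E]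
    (G : CiliatedGraph N E) (hG : G.IsPlane) (outer : G.Face)
    (ε : E → ℤˣ) (hε : G.IsKasteleyn n outer ε) :
    ∃ s : ℤˣ, ∀ q : ℂ, QAdmissible n q →
      ∀ (A : Type v) [Ring A] [Algebra ℂ A] (Φ : E → Matrix (Fin n) (Fin n) A),
        IsQuantumConnection q Φ →
          G.partitionFunction q Φ = (s : ℤ) • G.kasteleynDet ε q Φ := by
  obtain ⟨s, hs⟩ := G.exists_sign_crossing hG hε
  -- The sign comes from the crossing form alone and is fixed before `q`, `A` and `Φ` enter.
  refine ⟨s, fun q hq A _ _ Φ hΦ => ?_⟩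
  rw [CiliatedGraph.partitionFunction, CiliatedGraph.kasteleynDet, smul_comm (s : ℤ),
    G.sum_dimerCover_eq_sum_multiwebs, Finset.smul_sum (r := (s : ℤ))]
  congr 1
  refine Finset.sum_congr rfl fun m hm => ?_
  obtain ⟨-, hb, hw⟩ := Finset.mem_filter.1 hm
  exact G.quantumTrace_eq_sum_dimerCover (hs _ hb hw) hq hΦ fun e => Nat.lt_succ_iff.1 (m e).2
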